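/- Let $(N,\Omega)$ be a (finite-dimensional, smooth, Hausdorff, second countable) symplectic manifold. For $f\in\mathcal F(N)=C^\infty(N)$ let $X_f$ be the Hamiltonian vector field, $\Omega(X_f,\cdot)=df$, and let $\{f,g\}=\Omega(X_f,X_g)$; use the same conventions on every symplectic manifold. Let $M_c\subseteq N$ be a closed embedded submanifold (for instance the final constraint submanifold of a constrained Hamiltonian system on $N$, defined regularly by equating finitely many functions to $0$), and let $\omega_c$ be the pullback of $\Omega$ to $M_c$. Assume that $\ker\omega_c$ has constant rank and defines a regular foliation $K_c$ of $M_c$: the leaves of $K_c$ are connected integral manifolds of $\ker\omega_c$ that partition $M_c$, and the leaf space $\bar M_c=M_c/K_c$, with its quotient topology, is a smooth manifold (not required to be Hausdorff) such that the natural map $p_{K_c}\colon M_c\to\bar M_c$ is a submersion. Put $$R^{(c)}=\{f\in\mathcal F(N)\mid X_f(x)\in T_xM_c\ \text{for all } x\in M_c\},\qquad I^{(c)}=\{f\in R^{(c)}\mid f|_{M_c}=0\}.$$ Then the following hold. 1. There is a unique symplectic form $\bar\omega_c$ on $\bar M_c$ with $p_{K_c}^*\bar\omega_c=\omega_c$.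 With the bracket $\{\cdot,\cdot\}$ it defines, $\mathcal F(\bar M_c)=C^\infty(\bar M_c)$ is a Poisson algebra. With the bracket of $N$, $R^{(c)}$ is a Poisson algebra, and this bracket descends to a Poisson algebra structure on $R^{(c)}/I^{(c)}$. 2. For every $f\in R^{(c)}$ there is a unique $\bar f=(p_{K_c})_*f\in\mathcal F(\bar M_c)$ with $f|_{M_c}=p_{K_c}^*\bar f$. The map $(p_{K_c})_*\colon R^{(c)}\to\mathcal F(\bar M_c)$ is a surjective homomorphism of Poisson algebras with kernel $I^{(c)}$. 3. Consequently $(p_{K_c})_*$ induces an isomorphism of Poisson algebras $R^{(c)}/I^{(c)}\to\mathcal F(\bar M_c)$, $f+I^{(c)}\mapsto (p_{K_c})_*f$. -/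

import Mathlib

open scoped Manifold ContDiff

/-- A (not necessarily continuous) differential 2-form on a manifold `M` modelled on `E`. -/
abbrev TwoForm (E : Type*) [NormedAddCommGroup E] [NormedSpace ℝ E]
    (M : Type*) [TopologicalSpace M] [ChartedSpace E M] : Type _ :=
  ∀ x : M, TangentSpace 𝓘(ℝ, E) x [⋀^Fin 2]→L[ℝ] ℝ

namespace TwoForm

variable {E : Type*} [NormedAddCommGroup E] [NormedSpace ℝ E]
  {M : Type*} [TopologicalSpace M] [ChartedSpace E M]
  {F : Type*} [NormedAddCommGroup F] [NormedSpace ℝ F]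
  {S : Type*} [TopologicalSpace S] [ChartedSpace F S]

/-- The pullback `(f^*Ω)(x)(v, w) = Ω(f x)(df v, df w)`. -/
noncomputable def pullback (f : S → M) (Ω : TwoForm E M) : TwoForm F S := fun x =>
  (Ω (f x)).compContinuousLinearMap (mfderiv 𝓘(ℝ, F) 𝓘(ℝ, E) f x)

/-- The local representative of `Ω` in the preferred chart around `x₀`, that is, the pullback of
`Ω` by the inverse of this chart. It is meaningful on the (open) target of the chart. -/
noncomputable def inChart (Ω : TwoForm E M) (x₀ : M) : E → E [⋀^Fin 2]→L[ℝ] ℝ :=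
  pullback (F := E) (S := E) (extChartAt 𝓘(ℝ, E) x₀).symm Ω

/-- A 2-form is smooth if all its local representatives are. -/
def IsSmooth (Ω : TwoForm E M) : Prop :=
  ∀ x₀ : M, ContDiffOn ℝ ∞ (inChart Ω x₀) (extChartAt 𝓘(ℝ, E) x₀).target

/-- A 2-form is closed if the exterior derivatives of all its local representatives vanish. -/
def IsClosed (Ω : TwoForm E M) : Prop :=
  ∀ x₀ : M, ∀ y ∈ (extChartAt 𝓘(ℝ, E) x₀).target, extDeriv (inChart Ω x₀) y = 0

/-- The linear map `v ↦ Ω(x)(v, ·)`. -/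
noncomputable def flat (Ω : TwoForm E M) (x : M) :
    TangentSpace 𝓘(ℝ, E) x →ₗ[ℝ] Module.Dual ℝ (TangentSpace 𝓘(ℝ, E) x) :=
  LinearMap.mk₂ ℝ (fun v w => Ω x ![v, w])
    (fun v v' w => (Ω x).cons_add ![w] v v')
    (fun c v w => (Ω x).cons_smul ![w] c v)
    (fun v w w' => by
      have h := (Ω x).toAlternatingMap.map_update_add ![v, 0] 1 w w'
      have e : ∀ u, Function.update ![v, 0] 1 u = ![v, u] := fun u => by
        ext i; fin_cases i <;> rfl
      rw [e, e, e] at h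
      exact h)
    (fun c v w => by
      have h := (Ω x).toAlternatingMap.map_update_smul ![v, 0] 1 c w
      have e : ∀ u, Function.update ![v, 0] 1 u = ![v, u] := fun u => by
        ext i; fin_cases i <;> rfl
      rw [e, e] at h
      exact h)

/-- The kernel `{v | Ω(x)(v, w) = 0 for all w}` of `Ω` at `x`. -/
noncomputable def ker (Ω : TwoForm E M) (x : M) : Submodule ℝ (TangentSpace 𝓘(ℝ, E) x) :=
  LinearMap.ker (flat Ω x)

end TwoForm

/-- A symplectic form: a smooth closed nondegenerate 2-form. -/
@[ext]
structure SymplecticForm (E : Type*) [NormedAddCommGroup E] [NormedSpace ℝ E]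
    (M : Type*) [TopologicalSpace M] [ChartedSpace E M] where
  form : TwoForm E M
  smooth : TwoForm.IsSmooth form
  closed : TwoForm.IsClosed form
  nondegenerate : ∀ x : M, TwoForm.ker form x = ⊥

section Hamiltonian

variable {E : Type*} [NormedAddCommGroup E] [NormedSpace ℝ E]
  {M : Type*} [TopologicalSpace M] [ChartedSpace E M]

/-- The differential of a smooth real function, as a linear form on each tangent space. -/
noncomputable def differential (f : C^∞⟮𝓘(ℝ, E), M; ℝ⟯) (x : M) :
    Module.Dual ℝ (TangentSpace 𝓘(ℝ, E) x) :=
  (mfderiv 𝓘(ℝ, E) 𝓘(ℝ, ℝ) f x).toLinearMap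

theorem differential_add (f g : C^∞⟮𝓘(ℝ, E), M; ℝ⟯) (x : M) :
    differential (f + g) x = differential f x + differential g x := by
  have hf : MDifferentiableAt 𝓘(ℝ, E) 𝓘(ℝ, ℝ) f x := f.contMDiff.mdifferentiable (by simp) x
  have hg : MDifferentiableAt 𝓘(ℝ, E) 𝓘(ℝ, ℝ) g x := g.contMDiff.mdifferentiable (by simp) x
  have h := mfderiv_add hf hg
  ext v
  exact DFunLike.congr_fun h v

theorem differential_mul (f g : C^∞⟮𝓘(ℝ, E), M; ℝ⟯) (x : M) :
    differential (f * g) x = f x • differential g x + g x • differential f x := by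
  have hf : MDifferentiableAt 𝓘(ℝ, E) 𝓘(ℝ, ℝ) f x := f.contMDiff.mdifferentiable (by simp) x
  have hg : MDifferentiableAt 𝓘(ℝ, E) 𝓘(ℝ, ℝ) g x := g.contMDiff.mdifferentiable (by simp) x
  have h := (hf.hasMFDerivAt.mul hg.hasMFDerivAt).mfderiv
  ext v
  exact DFunLike.congr_fun h v

theorem differential_algebraMap (c : ℝ) (x : M) :
    differential (algebraMap ℝ C^∞⟮𝓘(ℝ, E), M; ℝ⟯ c) x = 0 := by
  have h : mfderiv 𝓘(ℝ, E) 𝓘(ℝ, ℝ) (fun _ : M => c) x = 0 := mfderiv_const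
  ext v
  exact DFunLike.congr_fun h v

namespace SymplecticForm

variable [FiniteDimensional ℝ E]

theorem flat_bijective (Ω : SymplecticForm E M) (x : M) :
    Function.Bijective (TwoForm.flat Ω.form x) := by
  have : FiniteDimensional ℝ (TangentSpace 𝓘(ℝ, E) x) :=
    inferInstanceAs (FiniteDimensional ℝ E)
  have hinj : Function.Injective (TwoForm.flat Ω.form x) :=
    LinearMap.ker_eq_bot.mp (Ω.nondegenerate x)
  exact ⟨hinj, (LinearMap.injective_iff_surjective_of_finrank_eq_finrank
    Subspace.dual_finrank_eq.symm).mp hinj⟩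

/-- The linear map `♯ = ♭⁻¹`, where `v♭ = Ω(x)(v, ·)`. -/
noncomputable def sharp (Ω : SymplecticForm E M) (x : M) :
    Module.Dual ℝ (TangentSpace 𝓘(ℝ, E) x) ≃ₗ[ℝ] TangentSpace 𝓘(ℝ, E) x :=
  (LinearEquiv.ofBijective (TwoForm.flat Ω.form x) (Ω.flat_bijective x)).symm

/-- The Hamiltonian vector field `X_f`, determined by `Ω(x)(X_f(x), ·) = df(x)`. -/
noncomputable def hamiltonian (Ω : SymplecticForm E M) (f : C^∞⟮𝓘(ℝ, E), M; ℝ⟯) (x : M) :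
    TangentSpace 𝓘(ℝ, E) x :=
  Ω.sharp x (differential f x)

/-- The Poisson bracket `{f, g}(x) = Ω(x)(X_f(x), X_g(x))`, as a function. -/
noncomputable def bracket (Ω : SymplecticForm E M) (f g : C^∞⟮𝓘(ℝ, E), M; ℝ⟯) (x : M) : ℝ :=
  Ω.form x ![Ω.hamiltonian f x, Ω.hamiltonian g x]

end SymplecticForm

end Hamiltonian

/-- A Poisson algebra structure on a commutative real algebra: a Lie bracket that is a derivation in
each argument. -/
structure PoissonStructure (A : Type*) [CommRing A] [Algebra ℝ A] where
  bracket : A →ₗ[ℝ] A →ₗ[ℝ] A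
  bracket_self : ∀ a, bracket a a = 0
  jacobi : ∀ a b c,
    bracket a (bracket b c) + bracket b (bracket c a) + bracket c (bracket a b) = 0
  leibniz : ∀ a b c, bracket a (b * c) = bracket a b * c + b * bracket a c

section Constraint

variable {E : Type*} [NormedAddCommGroup E] [NormedSpace ℝ E] [FiniteDimensional ℝ E]
  {N : Type*} [TopologicalSpace N] [ChartedSpace E N]
  {F : Type*} [NormedAddCommGroup F] [NormedSpace ℝ F]
  {S : Type*} [TopologicalSpace S] [ChartedSpace F S]

/-- The algebra of first class functions of the submanifold `ι : S → N`: the smooth functions on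
`N` whose Hamiltonian vector fields are tangent to `S` at all points of `S`. -/
noncomputable def firstClassFunctions (Ω : SymplecticForm E N) (ι : S → N) :
    Subalgebra ℝ C^∞⟮𝓘(ℝ, E), N; ℝ⟯ where
  carrier := {f | ∀ s : S, Ω.hamiltonian f (ι s) ∈
    LinearMap.range (mfderiv 𝓘(ℝ, F) 𝓘(ℝ, E) ι s).toLinearMap}
  mul_mem' := fun {f g} hf hg s => by
    have h : Ω.hamiltonian (f * g) (ι s)
        = f (ι s) • Ω.hamiltonian g (ι s) + g (ι s) • Ω.hamiltonian f (ι s) := by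
      simp [SymplecticForm.hamiltonian, differential_mul]
    rw [h]
    exact Submodule.add_mem _ (Submodule.smul_mem _ _ (hg s)) (Submodule.smul_mem _ _ (hf s))
  add_mem' := fun {f g} hf hg s => by
    have h : Ω.hamiltonian (f + g) (ι s) = Ω.hamiltonian f (ι s) + Ω.hamiltonian g (ι s) := by
      simp [SymplecticForm.hamiltonian, differential_add]
    rw [h]
    exact Submodule.add_mem _ (hf s) (hg s)
  algebraMap_mem' := fun c s => by
    have h : Ω.hamiltonian (algebraMap ℝ C^∞⟮𝓘(ℝ, E), N; ℝ⟯ c) (ι s) = 0 := by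
      simp [SymplecticForm.hamiltonian, differential_algebraMap]
    rw [h]
    exact Submodule.zero_mem _

/-- The ideal of first class constraints: the first class functions that vanish on `S`. -/
noncomputable def firstClassConstraints (Ω : SymplecticForm E N) (ι : S → N) :
    Ideal (firstClassFunctions (F := F) Ω ι) where
  carrier := {f | ∀ s : S, (f : C^∞⟮𝓘(ℝ, E), N; ℝ⟯) (ι s) = 0}
  add_mem' := fun {f g} hf hg s => by
    have h : ((f + g : firstClassFunctions (F := F) Ω ι) : C^∞⟮𝓘(ℝ, E), N; ℝ⟯) (ι s)
      = (f : C^∞⟮𝓘(ℝ, E), N; ℝ⟯) (ι s) + (g : C^∞⟮𝓘(ℝ, E), N; ℝ⟯) (ι s) := rfl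
    rw [h, hf s, hg s, add_zero]
  zero_mem' := fun _ => rfl
  smul_mem' := fun c f hf s => by
    have h : ((c • f : firstClassFunctions (F := F) Ω ι) : C^∞⟮𝓘(ℝ, E), N; ℝ⟯) (ι s)
      = (c : C^∞⟮𝓘(ℝ, E), N; ℝ⟯) (ι s) * (f : C^∞⟮𝓘(ℝ, E), N; ℝ⟯) (ι s) := rfl
    rw [h, hf s, mul_zero]

end Constraint

/-- The distribution `D` on `S` has constant rank `r` and is tangent to the foliation `K`, given by
its partition into leaves: every leaf is a connected integral manifold of `D`, that is, the image of
an injective immersion `j : L → S` of a connected (second countable) `r`-dimensional manifold `L`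
with `T_l L` mapped onto `D (j l)` for all `l`. For involutive `D` the classes of `K` are then the
maximal connected integral manifolds of `D`. -/
structure IsFoliationBy.{u} {F : Type*} [NormedAddCommGroup F] [NormedSpace ℝ F]
    {S : Type u} [TopologicalSpace S] [ChartedSpace F S]
    (D : ∀ s : S, Submodule ℝ (TangentSpace 𝓘(ℝ, F) s)) (r : ℕ) (K : Setoid S) : Prop where
  rank_eq : ∀ s : S, Module.finrank ℝ (D s) = r
  exists_leaf : ∀ s : S, ∃ (L : Type u) (_ : TopologicalSpace L)
    (_ : ChartedSpace (EuclideanSpace ℝ (Fin r)) L)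
    (_ : IsManifold 𝓘(ℝ, EuclideanSpace ℝ (Fin r)) ∞ L)
    (_ : SecondCountableTopology L) (_ : ConnectedSpace L) (j : L → S),
    Manifold.IsImmersion 𝓘(ℝ, EuclideanSpace ℝ (Fin r)) 𝓘(ℝ, F) ∞ j ∧
    Function.Injective j ∧ Set.range j = {t | K s t} ∧
    ∀ l : L, LinearMap.range
      (mfderiv 𝓘(ℝ, EuclideanSpace ℝ (Fin r)) 𝓘(ℝ, F) j l).toLinearMap = D (j l)

/-!
Write `p` for the projection of the submanifold `S` onto its leaf space and `ω` for the restriction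
of the symplectic form to `S`.

*The reduced form.* The kernel of `ω` is exactly `ker dp` (`IsFoliationBy.eq_ker_mfderiv`). It is
contained in `ker dp` because `p` is constant on the leaves. For the converse, choose charts in which
`p` is a projection `B × C → B`: there a fibre of `p` is an open piece of `C`, but it is also one
leaf, the smooth image of a second countable `r`-dimensional manifold, so that `dim C ≤ r` by
comparison of Hausdorff dimensions. In such charts the vertical vectors thus lie in `ker ω`, and as
`ω` is closed, its local representative does not change in the vertical directions
(`TwoForm.fderiv_vertical_eq_zero`). Hence the condition that `η ∘ (dp × dp) = ω`, for a form `η` on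
one tangent space of the leaf space, is locally constant along the leaves, and leaves are connected,
so `ω` descends (`exists_reduced_form`). Smoothness and closedness follow by pulling back along
local sections of `p`, nondegeneracy from `ker ω ⊆ ker dp`.

*The bracket on first class functions.* The bracket of a symplectic manifold satisfies the Jacobi
identity by a computation in charts (`TwoForm.jacobi_bracket`). A vector at a point of `S` is
tangent to `S` as soon as it annihilates all functions vanishing on `S`
(`mem_range_mfderiv_of_differential_eq_zero`). First class functions are therefore those whose
brackets preserve the ideal of these functions, and by the Jacobi identity they are closed under the
bracket (`smoothBracket_mem_firstClassFunctions`).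

*The map `p_*`.* If `X_f` is tangent to `S`, then the restriction of `df` to `S` is `ω(X_f, ·)`,
which kills `ker dp`, so that `f` is constant on the leaves; the function on the leaf space is
smooth because `p` has local sections. The vector field `X_f` is mapped by `dp` to the Hamiltonian
vector field of this function, which gives the compatibility with the brackets (`bracket_reduction`). The
map is surjective: a function `g` on the leaf space has local extensions to `N` whose Hamiltonian
vector fields along `S` are lifts of `X_g` (`exists_local_extension`), and they are glued by a
partition of unity (`exists_contMDiffMap_glue`). The kernel consists of the first class constraints,
and the Poisson structure of the quotient is transported along the induced isomorphism.
-/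

open Topology

set_option maxSynthPendingDepth 3

/-! ### Alternating 2-forms on a normed space -/

namespace TwoForm

section Bilin

variable {G : Type*} [NormedAddCommGroup G] [NormedSpace ℝ G]

/-- The continuous bilinear form underlying an alternating 2-form on a normed space. -/
noncomputable def bilin : (G [⋀^Fin 2]→L[ℝ] ℝ) →L[ℝ] G →L[ℝ] G →L[ℝ] ℝ :=
  (ContinuousLinearMap.compL ℝ G (G [⋀^Fin 1]→L[ℝ] ℝ) (G →L[ℝ] ℝ)
    ((ContinuousAlternatingMap.ofSubsingletonLIE (𝕜 := ℝ) (E := G) (F := ℝ)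
      (0 : Fin 1)).symm.toContinuousLinearEquiv :
      (G [⋀^Fin 1]→L[ℝ] ℝ) →L[ℝ] (G →L[ℝ] ℝ))).comp
  (ContinuousAlternatingMap.curryLeftLI (𝕜 := ℝ) (E := G) (F := ℝ) (n := 1)).toContinuousLinearMap

@[simp]
theorem bilin_apply (θ : G [⋀^Fin 2]→L[ℝ] ℝ) (v w : G) : bilin θ v w = θ ![v, w] := by
  change θ (Matrix.vecCons v fun _ => w) = _
  congr 1
  ext i; fin_cases i <;> rfl

theorem apply_swap (θ : G [⋀^Fin 2]→L[ℝ] ℝ) (v w : G) : θ ![w, v] = -θ ![v, w] := by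
  have h := θ.toAlternatingMap.map_swap ![v, w] (i := 0) (j := 1) (by decide)
  have e : (![v, w] ∘ Equiv.swap (0 : Fin 2) 1) = ![w, v] := by
    ext i; fin_cases i <;> simp
  rw [e] at h
  exact h

theorem ext_of_apply {θ θ' : G [⋀^Fin 2]→L[ℝ] ℝ} (h : ∀ v w, θ ![v, w] = θ' ![v, w]) :
    θ = θ' := by
  ext u
  have e : u = ![u 0, u 1] := by ext i; fin_cases i <;> rfl
  rw [e]
  exact h _ _

theorem compContinuousLinearMap_apply_pair {H : Type*} [NormedAddCommGroup H] [NormedSpace ℝ H]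
    (θ : G [⋀^Fin 2]→L[ℝ] ℝ) (A : H →L[ℝ] G) (v w : H) :
    θ.compContinuousLinearMap A ![v, w] = θ ![A v, A w] := by
  rw [ContinuousAlternatingMap.compContinuousLinearMap_apply]
  congr 1
  ext i; fin_cases i <;> rfl

theorem bilin_injective : Function.Injective (bilin (G := G)) := fun θ θ' h =>
  ext_of_apply fun v w => by rw [← bilin_apply, h, bilin_apply]

variable {H : Type*} [NormedAddCommGroup H] [NormedSpace ℝ H] [FiniteDimensional ℝ G]
  {n : WithTop ℕ∞} {θ : H → G [⋀^Fin 2]→L[ℝ] ℝ} {y : H}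

/-- In finite dimension `bilin` has a continuous linear left inverse, so that smoothness of a form
can be tested on the underlying bilinear forms. -/
theorem contDiffAt_iff_bilin :
    ContDiffAt ℝ n θ y ↔ ContDiffAt ℝ n (fun z => bilin (θ z)) y := by
  refine ⟨fun h => (bilin (G := G)).contDiff.contDiffAt.comp y h, fun h => ?_⟩
  obtain ⟨L, hL⟩ := LinearMap.exists_leftInverse_of_injective (bilin (G := G)).toLinearMap
    (LinearMap.ker_eq_bot.mpr bilin_injective)
  have e : θ = fun z => L.toContinuousLinearMap (bilin (θ z)) := by
    funext z
    exact (LinearMap.congr_fun hL (θ z)).symm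
  rw [e]
  exact L.toContinuousLinearMap.contDiff.contDiffAt.comp y h

theorem _root_.ContDiffAt.twoForm_comp [FiniteDimensional ℝ H]
    {K : Type*} [NormedAddCommGroup K] [NormedSpace ℝ K] {y : K}
    {θ : K → G [⋀^Fin 2]→L[ℝ] ℝ} {A : K → H →L[ℝ] G}
    (hθ : ContDiffAt ℝ n θ y) (hA : ContDiffAt ℝ n A y) :
    ContDiffAt ℝ n (fun z => (θ z).compContinuousLinearMap (A z)) y := by
  rw [contDiffAt_iff_bilin] at hθ ⊢
  have e : (fun z => bilin ((θ z).compContinuousLinearMap (A z))) =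
      fun z => ((ContinuousLinearMap.compL ℝ H G ℝ).flip (A z)).comp ((bilin (θ z)).comp (A z)) := by
    funext z
    ext v w
    rw [bilin_apply, compContinuousLinearMap_apply_pair]
    simp
  rw [e]
  exact ((ContinuousLinearMap.compL ℝ H G ℝ).flip.contDiff.contDiffAt.comp y hA).clm_comp
    (hθ.clm_comp hA)

theorem _root_.ContDiffAt.twoForm_apply {X Y : H → G} (hθ : ContDiffAt ℝ n θ y)
    (hX : ContDiffAt ℝ n X y) (hY : ContDiffAt ℝ n Y y) :
    ContDiffAt ℝ n (fun z => θ z ![X z, Y z]) y := by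
  simp only [← bilin_apply]
  exact ((contDiffAt_iff_bilin.mp hθ).clm_apply hX).clm_apply hY

omit [FiniteDimensional ℝ G] in
theorem fderiv_apply_pair (hθ : DifferentiableAt ℝ θ y) {X : H → G}
    (hX : DifferentiableAt ℝ X y) (w : G) (v : H) :
    fderiv ℝ (fun z => θ z ![X z, w]) y v = fderiv ℝ θ y v ![X y, w] + θ y ![fderiv ℝ X y v, w] := by
  have hb : HasFDerivAt (fun z => bilin (θ z)) (bilin.comp (fderiv ℝ θ y)) y :=
    bilin.hasFDerivAt.comp y hθ.hasFDerivAt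
  have h := ((hb.clm_apply hX.hasFDerivAt).clm_apply (hasFDerivAt_const w y)).fderiv
  simp only [bilin_apply] at h
  rw [h]
  simp [add_comm]

omit [FiniteDimensional ℝ G] in
theorem extDeriv_apply_three {θ : G → G [⋀^Fin 2]→L[ℝ] ℝ} {y : G} (hθ : DifferentiableAt ℝ θ y)
    (a b c : G) : extDeriv θ y ![a, b, c] =
      fderiv ℝ θ y a ![b, c] - fderiv ℝ θ y b ![a, c] + fderiv ℝ θ y c ![a, b] := by
  have h0 : (0 : Fin 3).removeNth ![a, b, c] = ![b, c] := by ext i; fin_cases i <;> rfl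
  have h1 : (1 : Fin 3).removeNth ![a, b, c] = ![a, c] := by ext i; fin_cases i <;> rfl
  have h2 : (2 : Fin 3).removeNth ![a, b, c] = ![a, b] := by ext i; fin_cases i <;> rfl
  rw [extDeriv_apply hθ]
  rw [Fin.sum_univ_three, h0, h1, h2]
  simp only [fderiv_continuousAlternatingMap_apply_const_apply hθ]
  simp
  ring

end Bilin

/-! ### Hamiltonian vector fields on a normed space -/

section Hamiltonian

variable {G : Type*} [NormedAddCommGroup G] [NormedSpace ℝ G]
  {θ : G → G [⋀^Fin 2]→L[ℝ] ℝ} {f g h : G → ℝ} {y : G}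

/-- The Hamiltonian vector field `X` of `f` with respect to a 2-form `θ` on a normed space, solving
`θ(X, ·) = df`. It is `0` where `θ` is degenerate. -/
noncomputable def hamVec (θ : G → G [⋀^Fin 2]→L[ℝ] ℝ) (f : G → ℝ) (y : G) : G :=
  (bilin (θ y)).inverse (fderiv ℝ f y)

theorem isInvertible_bilin [FiniteDimensional ℝ G] (hy : Function.Injective (bilin (θ y))) :
    (bilin (θ y)).IsInvertible := by
  have hfin : Module.finrank ℝ G = Module.finrank ℝ (G →L[ℝ] ℝ) := by
    rw [← (LinearMap.toContinuousLinearMap (𝕜 := ℝ) (E := G) (F' := ℝ)).finrank_eq]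
    exact Subspace.dual_finrank_eq.symm
  refine ⟨(LinearEquiv.ofInjectiveOfFinrankEq (bilin (θ y)).toLinearMap hy
    hfin).toContinuousLinearEquiv, ?_⟩
  ext v w
  rfl

variable [FiniteDimensional ℝ G]

theorem apply_hamVec (hy : Function.Injective (bilin (θ y))) (v : G) :
    θ y ![hamVec θ f y, v] = fderiv ℝ f y v := by
  rw [← bilin_apply, hamVec]
  obtain ⟨e, he⟩ := isInvertible_bilin hy
  rw [← he]
  simp

theorem contDiffAt_hamVec (hy : Function.Injective (bilin (θ y))) (hθ : ContDiffAt ℝ ∞ θ y)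
    (hf : ContDiffAt ℝ ∞ f y) : ContDiffAt ℝ ∞ (hamVec θ f) y :=
  ContDiffAt.clm_apply (f := fun z => (bilin (θ z)).inverse)
    (ContDiffAt.comp (g := ContinuousLinearMap.inverse) y
      (isInvertible_bilin hy).contDiffAt_map_inverse (contDiffAt_iff_bilin.mp hθ))
    (hf.fderiv_right (m := ∞) (by simp))

/-- The differential of the Poisson bracket `θ(X_f, X_g)`: the derivatives of the Hamiltonian vector
fields are eliminated with the help of their defining equations. -/
theorem fderiv_bracket (hy : ∀ᶠ z in 𝓝 y, Function.Injective (bilin (θ z)))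
    (hθ : ContDiffAt ℝ ∞ θ y) (hf : ContDiffAt ℝ ∞ f y) (hg : ContDiffAt ℝ ∞ g y) (v : G) :
    fderiv ℝ (fun z => θ z ![hamVec θ f z, hamVec θ g z]) y v =
      fderiv ℝ (fderiv ℝ f) y v (hamVec θ g y) - fderiv ℝ (fderiv ℝ g) y v (hamVec θ f y)
        - fderiv ℝ θ y v ![hamVec θ f y, hamVec θ g y] := by
  have hY := (contDiffAt_hamVec hy.self_of_nhds hθ hg).differentiableAt (by simp)
  have hdf : DifferentiableAt ℝ (fderiv ℝ f) y :=
    (hf.fderiv_right (m := ∞) (by simp)).differentiableAt (by simp)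
  have e1 : (fun z => θ z ![hamVec θ f z, hamVec θ g z]) =ᶠ[𝓝 y]
      fun z => fderiv ℝ f z (hamVec θ g z) := by
    filter_upwards [hy] with z hz using apply_hamVec hz _
  have e2 : (fun z => θ z ![hamVec θ g z, hamVec θ f y]) =ᶠ[𝓝 y]
      fun z => fderiv ℝ g z (hamVec θ f y) := by
    filter_upwards [hy] with z hz using apply_hamVec hz _
  have hdg : DifferentiableAt ℝ (fderiv ℝ g) y :=
    (hg.fderiv_right (m := ∞) (by simp)).differentiableAt (by simp)
  have h2 := fderiv_apply_pair (hθ.differentiableAt (by simp)) hY (hamVec θ f y) v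
  rw [e2.fderiv_eq, (hdg.hasFDerivAt.clm_apply (hasFDerivAt_const _ y)).fderiv] at h2
  rw [e1.fderiv_eq, (hdf.hasFDerivAt.clm_apply hY.hasFDerivAt).fderiv]
  have h3 := apply_hamVec (f := f) hy.self_of_nhds (fderiv ℝ (hamVec θ g) y v)
  rw [apply_swap] at h3
  rw [apply_swap (fderiv ℝ θ y v) (hamVec θ f y)] at h2
  simp at h2 ⊢
  linarith

/-- The Jacobi identity for the Poisson bracket of a nondegenerate closed 2-form. In the cyclic sum
of the derivatives of the brackets the second derivatives cancel by symmetry, and the rest is, up to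
sign, `dθ(X_f, X_g, X_h)`. -/
theorem jacobi_bracket (hy : ∀ᶠ z in 𝓝 y, Function.Injective (bilin (θ z)))
    (hθ : ContDiffAt ℝ ∞ θ y) (hd : extDeriv θ y = 0) (hf : ContDiffAt ℝ ∞ f y)
    (hg : ContDiffAt ℝ ∞ g y) (hh : ContDiffAt ℝ ∞ h y) :
    θ y ![hamVec θ f y, hamVec θ (fun z => θ z ![hamVec θ g z, hamVec θ h z]) y] +
    θ y ![hamVec θ g y, hamVec θ (fun z => θ z ![hamVec θ h z, hamVec θ f z]) y] +
    θ y ![hamVec θ h y, hamVec θ (fun z => θ z ![hamVec θ f z, hamVec θ g z]) y] = 0 := by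
  have hi := hy.self_of_nhds
  have hsymm : ∀ {k : G → ℝ}, ContDiffAt ℝ ∞ k y → ∀ v w,
      fderiv ℝ (fderiv ℝ k) y v w = fderiv ℝ (fderiv ℝ k) y w v := fun hk v w =>
    (hk.isSymmSndFDerivAt
      (by rw [minSmoothness_of_isRCLikeNormedField]; exact ENat.LEInfty.out)).eq v w
  have h3 := extDeriv_apply_three (hθ.differentiableAt (by simp))
    (hamVec θ f y) (hamVec θ g y) (hamVec θ h y)
  rw [hd, show (0 : G [⋀^Fin 3]→L[ℝ] ℝ) _ = 0 from rfl] at h3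
  rw [apply_swap (fderiv ℝ θ y (hamVec θ g y)) (hamVec θ h y)] at h3
  have key : ∀ k l : G → ℝ, θ y ![hamVec θ k y, hamVec θ l y] = -fderiv ℝ l y (hamVec θ k y) :=
    fun k l => by rw [apply_swap, apply_hamVec hi]
  rw [key, key, key, fderiv_bracket hy hθ hf hg, fderiv_bracket hy hθ hg hh,
    fderiv_bracket hy hθ hh hf]
  rw [hsymm hg (hamVec θ h y), hsymm hh (hamVec θ f y), hsymm hf (hamVec θ g y)]
  linarith

end Hamiltonian

/-- If the vertical vectors of a product lie in the kernel of a closed 2-form, then the form does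
not change in the vertical directions. -/
theorem fderiv_vertical_eq_zero {B C : Type*} [NormedAddCommGroup B] [NormedSpace ℝ B]
    [NormedAddCommGroup C] [NormedSpace ℝ C] {θ : B × C → (B × C) [⋀^Fin 2]→L[ℝ] ℝ} {z : B × C}
    (hθ : DifferentiableAt ℝ θ z) (hd : extDeriv θ z = 0)
    (hk : ∀ᶠ z' in 𝓝 z, ∀ (c : C) (v : B × C), θ z' ![(0, c), v] = 0) (c : C) :
    fderiv ℝ θ z (0, c) = 0 := by
  refine ext_of_apply fun a b => ?_
  have hv : ∀ (u v : B × C), fderiv ℝ θ z u ![(0, c), v] = 0 := fun u v => by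
    have e : (fun z' => θ z' ![(0, c), v]) =ᶠ[𝓝 z] fun _ => 0 := hk.mono fun z' h => h c v
    rw [← fderiv_continuousAlternatingMap_apply_const_apply hθ, e.fderiv_eq]
    simp
  have h3 := extDeriv_apply_three hθ (0, c) a b
  rw [hd, hv, hv] at h3
  simpa using h3.symm

end TwoForm

/-! ### Pullbacks of 2-forms -/

/-- A local chart of `M` with values in a normed space (not necessarily the model space of `M`) that
is smooth in both directions. -/
def OpenPartialHomeomorph.IsSmoothChart {E : Type*} [NormedAddCommGroup E] [NormedSpace ℝ E]
    {M : Type*} [TopologicalSpace M] [ChartedSpace E M]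
    {G : Type*} [NormedAddCommGroup G] [NormedSpace ℝ G] (Θ : OpenPartialHomeomorph M G) : Prop :=
  ContMDiffOn 𝓘(ℝ, E) 𝓘(ℝ, G) ∞ Θ Θ.source ∧ ContMDiffOn 𝓘(ℝ, G) 𝓘(ℝ, E) ∞ Θ.symm Θ.target

namespace OpenPartialHomeomorph.IsSmoothChart

variable {E : Type*} [NormedAddCommGroup E] [NormedSpace ℝ E]
  {M : Type*} [TopologicalSpace M] [ChartedSpace E M]
  {G : Type*} [NormedAddCommGroup G] [NormedSpace ℝ G] {Θ : OpenPartialHomeomorph M G}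

theorem contMDiffAt (h : Θ.IsSmoothChart (E := E)) {x : M} (hx : x ∈ Θ.source) :
    ContMDiffAt 𝓘(ℝ, E) 𝓘(ℝ, G) ∞ Θ x :=
  h.1.contMDiffAt (Θ.open_source.mem_nhds hx)

theorem contMDiffAt_symm (h : Θ.IsSmoothChart (E := E)) {y : G} (hy : y ∈ Θ.target) :
    ContMDiffAt 𝓘(ℝ, G) 𝓘(ℝ, E) ∞ Θ.symm y :=
  h.2.contMDiffAt (Θ.open_target.mem_nhds hy)

theorem mdifferentiable (h : Θ.IsSmoothChart (E := E)) :
    Θ.MDifferentiable 𝓘(ℝ, E) 𝓘(ℝ, G) :=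
  ⟨h.1.mdifferentiableOn (by simp), h.2.mdifferentiableOn (by simp)⟩

theorem bijective_mfderiv_symm [IsManifold 𝓘(ℝ, E) ∞ M] (h : Θ.IsSmoothChart (E := E)) {y : G}
    (hy : y ∈ Θ.target) : Function.Bijective (mfderiv 𝓘(ℝ, G) 𝓘(ℝ, E) Θ.symm y) :=
  h.mdifferentiable.symm.mfderiv_bijective hy

theorem chartAt [IsManifold 𝓘(ℝ, E) ∞ M] (x : M) : (chartAt E x).IsSmoothChart (E := E) :=
  ⟨contMDiffOn_chart, contMDiffOn_chart_symm⟩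

end OpenPartialHomeomorph.IsSmoothChart

namespace TwoForm

variable {E : Type*} [NormedAddCommGroup E] [NormedSpace ℝ E]
  {M : Type*} [TopologicalSpace M] [ChartedSpace E M]
  {F : Type*} [NormedAddCommGroup F] [NormedSpace ℝ F]
  {S : Type*} [TopologicalSpace S] [ChartedSpace F S]
  {G : Type*} [NormedAddCommGroup G] [NormedSpace ℝ G]
  {T : Type*} [TopologicalSpace T] [ChartedSpace G T]

theorem pullback_apply (f : S → M) (Ω : TwoForm E M) (x : S) (v w : TangentSpace 𝓘(ℝ, F) x) :
    pullback (F := F) f Ω x ![v, w] =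
      Ω (f x) ![mfderiv 𝓘(ℝ, F) 𝓘(ℝ, E) f x v, mfderiv 𝓘(ℝ, F) 𝓘(ℝ, E) f x w] :=
  compContinuousLinearMap_apply_pair (G := E) (H := F) (Ω (f x)) _ v w

theorem pullback_pullback {f : S → M} {g : T → S} {x : T} (Ω : TwoForm E M)
    (hf : MDifferentiableAt 𝓘(ℝ, F) 𝓘(ℝ, E) f (g x))
    (hg : MDifferentiableAt 𝓘(ℝ, G) 𝓘(ℝ, F) g x) :
    pullback (F := G) g (pullback (F := F) f Ω) x = pullback (F := G) (f ∘ g) Ω x := by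
  refine ext_of_apply (G := G) fun v w => ?_
  refine (pullback_apply g _ x v w).trans ((pullback_apply f Ω _ _ _).trans ?_)
  refine Eq.trans ?_ (pullback_apply (f ∘ g) Ω x v w).symm
  rw [mfderiv_comp x hf hg]
  rfl

theorem pullback_congr {f g : S → M} {x : S} (Ω : TwoForm E M) (h : f =ᶠ[𝓝 x] g) :
    pullback (F := F) f Ω x = pullback (F := F) g Ω x := by
  have key : ∀ (a b : M) (v v' w w' : E), a = b → v = v' → w = w' →
      (Ω a ![v, w] : ℝ) = Ω b ![v', w'] := by
    rintro a _ v _ w _ rfl rfl rfl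
    rfl
  have hd : ∀ v : F, (mfderiv 𝓘(ℝ, F) 𝓘(ℝ, E) f x v : E) = mfderiv 𝓘(ℝ, F) 𝓘(ℝ, E) g x v :=
    fun v => DFunLike.congr_fun h.mfderiv_eq v
  refine ext_of_apply (G := F) fun v w => (pullback_apply f Ω x v w).trans ?_
  exact (key _ _ _ _ _ _ h.self_of_nhds (hd v) (hd w)).trans (pullback_apply g Ω x v w).symm

variable [IsManifold 𝓘(ℝ, E) ∞ M] {g : G → M} {y : G} {Ω : TwoForm E M}

/-- Near `y` the pullback along a map `g` from a normed space is the pullback of a local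
representative of the form along the coordinate expression of `g`. -/
theorem pullback_eventuallyEq (hg : ContMDiffAt 𝓘(ℝ, G) 𝓘(ℝ, E) ∞ g y) :
    pullback (F := G) g Ω =ᶠ[𝓝 y] fun z =>
      (inChart Ω (g y) (extChartAt 𝓘(ℝ, E) (g y) (g z))).compContinuousLinearMap
        (fderiv ℝ (extChartAt 𝓘(ℝ, E) (g y) ∘ g) z) := by
  have hsm : ∀ᶠ z in 𝓝 y, ContMDiffAt 𝓘(ℝ, G) 𝓘(ℝ, E) 1 g z :=
    (contMDiffAt_iff_contMDiffAt_nhds (by simp)).mp (hg.of_le (by simp))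
  have hsrc : ∀ᶠ z in 𝓝 y, g z ∈ (chartAt E (g y)).source :=
    hg.continuousAt.preimage_mem_nhds
      ((chartAt E (g y)).open_source.mem_nhds (mem_chart_source E (g y)))
  filter_upwards [hsm, hsrc, hsrc.eventually_nhds] with z hz hz' hz''
  have hchart := (OpenPartialHomeomorph.IsSmoothChart.chartAt (E := E) (g y)).mdifferentiable
  have hd : MDifferentiableAt 𝓘(ℝ, G) 𝓘(ℝ, E) g z := hz.mdifferentiableAt (by simp)
  have hc : MDifferentiableAt 𝓘(ℝ, G) 𝓘(ℝ, E) (extChartAt 𝓘(ℝ, E) (g y) ∘ g) z :=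
    (hchart.mdifferentiableAt hz').comp z hd
  have hcs : MDifferentiableAt 𝓘(ℝ, E) 𝓘(ℝ, E) (extChartAt 𝓘(ℝ, E) (g y)).symm
      ((extChartAt 𝓘(ℝ, E) (g y) ∘ g) z) :=
    hchart.mdifferentiableAt_symm ((chartAt E (g y)).map_source hz')
  have h1 : pullback (F := G) g Ω z = pullback (F := G)
      ((extChartAt 𝓘(ℝ, E) (g y)).symm ∘ (extChartAt 𝓘(ℝ, E) (g y) ∘ g)) Ω z := by
    refine pullback_congr Ω ?_
    filter_upwards [hz''] with w hw
    exact ((chartAt E (g y)).left_inv hw).symm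
  rw [h1, ← pullback_pullback Ω hcs hc]
  rw [← mfderiv_eq_fderiv]
  rfl

omit [IsManifold 𝓘(ℝ, E) ∞ M] in
theorem contDiffAt_extChartAt_comp (hg : ContMDiffAt 𝓘(ℝ, G) 𝓘(ℝ, E) ∞ g y) :
    ContDiffAt ℝ ∞ (extChartAt 𝓘(ℝ, E) (g y) ∘ g) y :=
  ((contMDiffAt_extChartAt (I := 𝓘(ℝ, E)) (x := g y)).comp y hg).contDiffAt

omit [IsManifold 𝓘(ℝ, E) ∞ M] in
theorem contDiffAt_inChart (hΩ : IsSmooth Ω) (x : M) :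
    ContDiffAt ℝ ∞ (inChart Ω x) (extChartAt 𝓘(ℝ, E) x x) :=
  (hΩ x).contDiffAt (extChartAt_target_mem_nhds x)

theorem contDiffAt_pullback [FiniteDimensional ℝ E] [FiniteDimensional ℝ G] (hΩ : IsSmooth Ω)
    (hg : ContMDiffAt 𝓘(ℝ, G) 𝓘(ℝ, E) ∞ g y) :
    ContDiffAt (E := G) (F := G [⋀^Fin 2]→L[ℝ] ℝ) ℝ ∞ (pullback (F := G) g Ω) y := by
  refine ContDiffAt.congr_of_eventuallyEq ?_ (pullback_eventuallyEq hg)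
  have hc := contDiffAt_extChartAt_comp hg
  exact ContDiffAt.twoForm_comp
    (ContDiffAt.comp (g := inChart Ω (g y)) y (contDiffAt_inChart hΩ (g y)) hc)
    (hc.fderiv_right (m := ∞) (by simp))

theorem extDeriv_pullback_eq_zero (hΩ : IsSmooth Ω) (hd : IsClosed Ω)
    (hg : ContMDiffAt 𝓘(ℝ, G) 𝓘(ℝ, E) ∞ g y) :
    extDeriv (E := G) (F := ℝ) (pullback (F := G) g Ω) y = 0 := by
  rw [(pullback_eventuallyEq hg).extDeriv_eq]
  have h := extDeriv_pullback (f := extChartAt 𝓘(ℝ, E) (g y) ∘ g) (x := y)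
    (r := ∞) ((contDiffAt_inChart hΩ (g y)).differentiableAt (by simp))
    (contDiffAt_extChartAt_comp hg)
    (by rw [minSmoothness_of_isRCLikeNormedField]; exact ENat.LEInfty.out)
  refine h.trans ?_
  rw [Function.comp_apply, hd (g y) _ (mem_extChartAt_target (g y))]
  rfl

omit [IsManifold 𝓘(ℝ, E) ∞ M] in
theorem injective_bilin_pullback (hΩ : ker Ω (g y) = ⊥)
    (hg : Function.Bijective (mfderiv 𝓘(ℝ, G) 𝓘(ℝ, E) g y)) :
    Function.Injective (bilin (G := G) (pullback (F := G) g Ω y)) := by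
  refine (injective_iff_map_eq_zero _).mpr fun v hv => ?_
  have h : mfderiv 𝓘(ℝ, G) 𝓘(ℝ, E) g y v ∈ ker Ω (g y) := by
    refine LinearMap.mem_ker.mpr (LinearMap.ext fun w => ?_)
    obtain ⟨w, rfl⟩ := hg.2 w
    have h := DFunLike.congr_fun hv w
    exact (pullback_apply g Ω y v w).symm.trans ((bilin_apply (G := G) _ v w).symm.trans h)
  rw [hΩ] at h
  exact hg.1 (((Submodule.mem_bot ℝ).mp h).trans (map_zero _).symm)

end TwoForm

/-! ### The Poisson algebra of a symplectic manifold -/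

section Differential

variable {E : Type*} [NormedAddCommGroup E] [NormedSpace ℝ E]
  {M : Type*} [TopologicalSpace M] [ChartedSpace E M]

theorem differential_smul (c : ℝ) (f : C^∞⟮𝓘(ℝ, E), M; ℝ⟯) (x : M) :
    differential (c • f) x = c • differential f x := by
  rw [Algebra.smul_def, differential_mul, differential_algebraMap, smul_zero, add_zero]
  rfl

end Differential

namespace SymplecticForm

variable {E : Type*} [NormedAddCommGroup E] [NormedSpace ℝ E]
  {M : Type*} [TopologicalSpace M] [ChartedSpace E M] [FiniteDimensional ℝ E]
  (Ω : SymplecticForm E M) (f g h : C^∞⟮𝓘(ℝ, E), M; ℝ⟯)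

theorem flat_sharp (x : M) (l : Module.Dual ℝ (TangentSpace 𝓘(ℝ, E) x)) :
    TwoForm.flat Ω.form x (Ω.sharp x l) = l :=
  LinearEquiv.apply_symm_apply (LinearEquiv.ofBijective _ (Ω.flat_bijective x)) l

theorem sharp_flat (x : M) (v : TangentSpace 𝓘(ℝ, E) x) :
    Ω.sharp x (TwoForm.flat Ω.form x v) = v :=
  LinearEquiv.symm_apply_apply (LinearEquiv.ofBijective _ (Ω.flat_bijective x)) v

theorem form_hamiltonian (x : M) (v : TangentSpace 𝓘(ℝ, E) x) :
    Ω.form x ![Ω.hamiltonian f x, v] = differential f x v :=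
  LinearMap.congr_fun (Ω.flat_sharp x (differential f x)) v

theorem eq_sharp {x : M} {X : TangentSpace 𝓘(ℝ, E) x}
    {l : Module.Dual ℝ (TangentSpace 𝓘(ℝ, E) x)} (hX : ∀ v, Ω.form x ![X, v] = l v) :
    X = Ω.sharp x l := by
  have e : TwoForm.flat Ω.form x X = l := LinearMap.ext hX
  rw [← e, sharp_flat]

theorem bracket_eq (x : M) :
    Ω.bracket f g x = differential f x (Ω.sharp x (differential g x)) :=
  Ω.form_hamiltonian f x _

theorem bracket_swap (x : M) : Ω.bracket g f x = -Ω.bracket f g x :=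
  TwoForm.apply_swap (G := E) (Ω.form x) _ _

variable {G : Type*} [NormedAddCommGroup G] [NormedSpace ℝ G] [FiniteDimensional ℝ G]

/-- The Hamiltonian vector field in a local parametrization `ψ`. -/
theorem mfderiv_hamVec {ψ : G → M} {y : G} (hψ : MDifferentiableAt 𝓘(ℝ, G) 𝓘(ℝ, E) ψ y)
    (hbij : Function.Bijective (mfderiv 𝓘(ℝ, G) 𝓘(ℝ, E) ψ y)) :
    mfderiv 𝓘(ℝ, G) 𝓘(ℝ, E) ψ y
      (TwoForm.hamVec (G := G) (TwoForm.pullback (F := G) ψ Ω.form) (f ∘ ψ) y) =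
    Ω.hamiltonian f (ψ y) := by
  refine Ω.eq_sharp fun v => ?_
  obtain ⟨v, rfl⟩ := hbij.2 v
  refine (TwoForm.pullback_apply ψ Ω.form y _ v).symm.trans ?_
  refine (TwoForm.apply_hamVec (G := G)
    (TwoForm.injective_bilin_pullback (Ω.nondegenerate _) hbij) v).trans ?_
  rw [← mfderiv_eq_fderiv, mfderiv_comp y (f.contMDiff.mdifferentiable (by simp) _) hψ]
  rfl

theorem bracket_comp {ψ : G → M} {y : G} (hψ : MDifferentiableAt 𝓘(ℝ, G) 𝓘(ℝ, E) ψ y)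
    (hbij : Function.Bijective (mfderiv 𝓘(ℝ, G) 𝓘(ℝ, E) ψ y)) :
    Ω.bracket f g (ψ y) = TwoForm.pullback (F := G) ψ Ω.form y
      ![TwoForm.hamVec (G := G) (TwoForm.pullback (F := G) ψ Ω.form) (f ∘ ψ) y,
        TwoForm.hamVec (G := G) (TwoForm.pullback (F := G) ψ Ω.form) (g ∘ ψ) y] := by
  rw [bracket, ← Ω.mfderiv_hamVec f hψ hbij, ← Ω.mfderiv_hamVec g hψ hbij]
  exact (TwoForm.pullback_apply ψ Ω.form y _ _).symm

end SymplecticForm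

namespace SymplecticForm

variable {E : Type*} [NormedAddCommGroup E] [NormedSpace ℝ E]
  {M : Type*} [TopologicalSpace M] [ChartedSpace E M] [FiniteDimensional ℝ E]
  {G : Type*} [NormedAddCommGroup G] [NormedSpace ℝ G]
  [IsManifold 𝓘(ℝ, E) ∞ M] (Ω : SymplecticForm E M) (f g h : C^∞⟮𝓘(ℝ, E), M; ℝ⟯)
  {Θ : OpenPartialHomeomorph M G} (hΘ : Θ.IsSmoothChart (E := E))
  {y : G} (hy : y ∈ Θ.target)

include hΘ hy

omit [FiniteDimensional ℝ E] [IsManifold 𝓘(ℝ, E) ∞ M] in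
theorem contDiffAt_comp_symm : ContDiffAt ℝ ∞ (f ∘ Θ.symm) y :=
  (f.contMDiff.contMDiffAt.comp y (hΘ.contMDiffAt_symm hy)).contDiffAt

omit [FiniteDimensional ℝ E] in
theorem eventually_injective_bilin :
    ∀ᶠ z in 𝓝 y, Function.Injective
      (TwoForm.bilin (G := G) (TwoForm.pullback (F := G) Θ.symm Ω.form z)) := by
  filter_upwards [Θ.open_target.mem_nhds hy] with z hz
  exact TwoForm.injective_bilin_pullback (Ω.nondegenerate _) (hΘ.bijective_mfderiv_symm hz)

variable [FiniteDimensional ℝ G]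

theorem bracket_comp_eventuallyEq :
    (fun z => Ω.bracket f g (Θ.symm z)) =ᶠ[𝓝 y] fun z =>
      TwoForm.pullback (F := G) Θ.symm Ω.form z
        ![TwoForm.hamVec (G := G) (TwoForm.pullback (F := G) Θ.symm Ω.form) (f ∘ Θ.symm) z,
          TwoForm.hamVec (G := G) (TwoForm.pullback (F := G) Θ.symm Ω.form) (g ∘ Θ.symm) z] := by
  filter_upwards [Θ.open_target.mem_nhds hy] with z hz
  exact Ω.bracket_comp f g ((hΘ.contMDiffAt_symm hz).mdifferentiableAt (by simp))
    (hΘ.bijective_mfderiv_symm hz)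

theorem contDiffAt_hamVec_chart :
    ContDiffAt ℝ ∞
      (TwoForm.hamVec (G := G) (TwoForm.pullback (F := G) Θ.symm Ω.form) (f ∘ Θ.symm)) y :=
  TwoForm.contDiffAt_hamVec (G := G)
    (TwoForm.injective_bilin_pullback (Ω.nondegenerate _) (hΘ.bijective_mfderiv_symm hy))
    (TwoForm.contDiffAt_pullback Ω.smooth (hΘ.contMDiffAt_symm hy)) (contDiffAt_comp_symm f hΘ hy)

omit hΘ hy [FiniteDimensional ℝ G]

theorem contMDiff_bracket : ContMDiff 𝓘(ℝ, E) 𝓘(ℝ, ℝ) ∞ (Ω.bracket f g) := fun x => by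
  have hΘ := OpenPartialHomeomorph.IsSmoothChart.chartAt (E := E) x
  have hx := mem_chart_source E x
  have hy := (chartAt E x).map_source hx
  have h1 : ContDiffAt ℝ ∞ (fun z => Ω.bracket f g ((chartAt E x).symm z)) (chartAt E x x) :=
    (ContDiffAt.twoForm_apply (G := E)
      (TwoForm.contDiffAt_pullback Ω.smooth (hΘ.contMDiffAt_symm hy))
      (Ω.contDiffAt_hamVec_chart f hΘ hy)
      (Ω.contDiffAt_hamVec_chart g hΘ hy)).congr_of_eventuallyEq
      (Ω.bracket_comp_eventuallyEq f g hΘ hy)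
  refine (h1.contMDiffAt.comp x (hΘ.contMDiffAt hx)).congr_of_eventuallyEq ?_
  filter_upwards [(chartAt E x).open_source.mem_nhds hx] with z hz
  simp [(chartAt E x).left_inv hz]

/-- The Poisson bracket as an operation on smooth functions. -/
noncomputable def smoothBracket : C^∞⟮𝓘(ℝ, E), M; ℝ⟯ :=
  ⟨Ω.bracket f g, Ω.contMDiff_bracket f g⟩

/-- The Jacobi identity, transported from the preferred chart at `x`. -/
theorem jacobi (x : M) :
    Ω.bracket f (Ω.smoothBracket g h) x + Ω.bracket g (Ω.smoothBracket h f) x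
      + Ω.bracket h (Ω.smoothBracket f g) x = 0 := by
  have hΘ := OpenPartialHomeomorph.IsSmoothChart.chartAt (E := E) x
  have hx := mem_chart_source E x
  have hy := (chartAt E x).map_source hx
  have key : ∀ a b c : C^∞⟮𝓘(ℝ, E), M; ℝ⟯, _ := fun a b c =>
    (congrArg (Ω.bracket a (Ω.smoothBracket b c)) ((chartAt E x).left_inv hx)).symm.trans
      ((Ω.bracket_comp_eventuallyEq a (Ω.smoothBracket b c) hΘ hy).self_of_nhds)
  have hham : ∀ b c : C^∞⟮𝓘(ℝ, E), M; ℝ⟯, _ := fun b c =>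
    congrArg (ContinuousLinearMap.inverse (TwoForm.bilin (G := E)
      (TwoForm.pullback (F := E) (chartAt E x).symm Ω.form (chartAt E x x))))
      (Ω.bracket_comp_eventuallyEq b c hΘ hy).fderiv_eq
  have hj := TwoForm.jacobi_bracket (G := E) (Ω.eventually_injective_bilin hΘ hy)
    (TwoForm.contDiffAt_pullback Ω.smooth (hΘ.contMDiffAt_symm hy))
    (TwoForm.extDeriv_pullback_eq_zero Ω.smooth Ω.closed (hΘ.contMDiffAt_symm hy))
    (contDiffAt_comp_symm f hΘ hy) (contDiffAt_comp_symm g hΘ hy) (contDiffAt_comp_symm h hΘ hy)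
  have key' : ∀ a b c : C^∞⟮𝓘(ℝ, E), M; ℝ⟯, Ω.bracket a (Ω.smoothBracket b c) x = _ := fun a b c =>
    (key a b c).trans (congrArg (fun X => TwoForm.pullback (F := E) (chartAt E x).symm Ω.form
      (chartAt E x x) ![TwoForm.hamVec (G := E)
        (TwoForm.pullback (F := E) (chartAt E x).symm Ω.form) (a ∘ (chartAt E x).symm)
          (chartAt E x x), X]) (hham b c))
  rw [key', key', key']
  exact hj

/-- The Poisson algebra of smooth functions on a symplectic manifold. -/
noncomputable def poisson : PoissonStructure C^∞⟮𝓘(ℝ, E), M; ℝ⟯ where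
  bracket := LinearMap.mk₂ ℝ Ω.smoothBracket
    (fun f f' g => by
      ext x
      change Ω.bracket (f + f') g x = Ω.bracket f g x + Ω.bracket f' g x
      simp [bracket_eq, differential_add])
    (fun c f g => by
      ext x
      change Ω.bracket (c • f) g x = c * Ω.bracket f g x
      simp [bracket_eq, differential_smul])
    (fun f g g' => by
      ext x
      change Ω.bracket f (g + g') x = Ω.bracket f g x + Ω.bracket f g' x
      simp [bracket_eq, differential_add])
    (fun c f g => by
      ext x
      change Ω.bracket f (c • g) x = c * Ω.bracket f g x
      simp [bracket_eq, differential_smul])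
  bracket_self f := by
    ext x
    exact (Ω.form x).map_eq_zero_of_eq (v := ![Ω.hamiltonian f x, Ω.hamiltonian f x])
      (i := 0) (j := 1) rfl (by decide)
  jacobi f g h := by
    ext x
    exact Ω.jacobi f g h x
  leibniz f g h := by
    ext x
    change Ω.bracket f (g * h) x = Ω.bracket f g x * h x + g x * Ω.bracket f h x
    simp [bracket_eq, differential_mul]
    ring

end SymplecticForm

namespace PoissonStructure

variable {A : Type*} [CommRing A] [Algebra ℝ A]

/-- The restriction of a Poisson structure to a subalgebra that is closed under the bracket. -/
def restrict (P : PoissonStructure A) (R : Subalgebra ℝ A)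
    (hR : ∀ f ∈ R, ∀ g ∈ R, P.bracket f g ∈ R) : PoissonStructure R where
  bracket := LinearMap.mk₂ ℝ (fun f g => ⟨P.bracket f g, hR f f.2 g g.2⟩)
    (fun f f' g => by ext; simp) (fun c f g => by ext; simp)
    (fun f g g' => by ext; simp) (fun c f g => by ext; simp)
  bracket_self f := Subtype.ext (P.bracket_self f)
  jacobi f g h := Subtype.ext (P.jacobi f g h)
  leibniz f g h := Subtype.ext (P.leibniz f g h)

/-- The transport of a Poisson structure along an isomorphism of algebras. -/
def comap {A' : Type*} [CommRing A'] [Algebra ℝ A'] (P : PoissonStructure A') (e : A ≃ₐ[ℝ] A') :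
    PoissonStructure A where
  bracket := LinearMap.mk₂ ℝ (fun f g => e.symm (P.bracket (e f) (e g)))
    (fun f f' g => by simp) (fun c f g => by simp)
    (fun f g g' => by simp) (fun c f g => by simp)
  bracket_self f := by simp [P.bracket_self]
  jacobi f g h := by simp [← map_add, P.jacobi]
  leibniz f g h := by simp [P.leibniz]

end PoissonStructure

/-! ### Normal forms of submersions and embeddings -/

section NormalForm

universe uE uF

variable {F : Type uF} [NormedAddCommGroup F] [NormedSpace ℝ F]
  {S : Type*} [TopologicalSpace S] [ChartedSpace F S]
  {B : Type*} [NormedAddCommGroup B] [NormedSpace ℝ B]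
  {Q : Type*} [TopologicalSpace Q] [ChartedSpace B Q]
  {C : Type*} [NormedAddCommGroup C] [NormedSpace ℝ C]

namespace OpenPartialHomeomorph.IsSmoothChart

variable {E : Type*} [NormedAddCommGroup E] [NormedSpace ℝ E]
  {M : Type*} [TopologicalSpace M] [ChartedSpace E M]
  {G : Type*} [NormedAddCommGroup G] [NormedSpace ℝ G] {Θ : OpenPartialHomeomorph M G}
  {G' : Type*} [NormedAddCommGroup G'] [NormedSpace ℝ G']

theorem of_mem_maximalAtlas {φ : OpenPartialHomeomorph M E}
    (h : φ ∈ IsManifold.maximalAtlas 𝓘(ℝ, E) ∞ M) : φ.IsSmoothChart (E := E) :=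
  ⟨contMDiffOn_of_mem_maximalAtlas h, contMDiffOn_symm_of_mem_maximalAtlas h⟩

theorem trans (h : Θ.IsSmoothChart (E := E)) {T : OpenPartialHomeomorph G G'}
    (hT : T.IsSmoothChart (E := G)) : (Θ.trans T).IsSmoothChart (E := E) := by
  refine ⟨fun x hx => ?_, fun y hy => ?_⟩
  · rw [trans_source] at hx
    exact ((hT.contMDiffAt hx.2).comp x (h.contMDiffAt hx.1)).contMDiffWithinAt
  · rw [trans_target] at hy
    exact ((h.contMDiffAt_symm hy.2).comp y (hT.contMDiffAt_symm hy.1)).contMDiffWithinAt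

theorem symm_trans (h : Θ.IsSmoothChart (E := E)) {T : OpenPartialHomeomorph M G'}
    (hT : T.IsSmoothChart (E := E)) : (Θ.symm.trans T).IsSmoothChart (E := G) := by
  refine ⟨fun x hx => ?_, fun y hy => ?_⟩
  · rw [trans_source] at hx
    exact ((hT.contMDiffAt hx.2).comp x (h.contMDiffAt_symm hx.1)).contMDiffWithinAt
  · rw [trans_target] at hy
    exact ((h.contMDiffAt hy.2).comp y (hT.contMDiffAt_symm hy.1)).contMDiffWithinAt

theorem restrOpen (h : Θ.IsSmoothChart (E := E)) {U : Set M} (hU : IsOpen U) :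
    (Θ.restrOpen U hU).IsSmoothChart (E := E) := by
  refine ⟨h.1.mono ?_, h.2.mono ?_⟩
  · rw [restrOpen_source]
    exact Set.inter_subset_left
  · exact Set.inter_subset_left

theorem continuousLinearEquiv (e : G ≃L[ℝ] G') :
    e.toHomeomorph.toOpenPartialHomeomorph.IsSmoothChart (E := G) :=
  ⟨e.contDiff.contMDiff.contMDiffOn, e.symm.contDiff.contMDiff.contMDiffOn⟩

theorem prod_refl {T : OpenPartialHomeomorph G G'} (hT : T.IsSmoothChart (E := G)) :
    (T.prod (OpenPartialHomeomorph.refl C)).IsSmoothChart (E := G × C) := by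
  refine ⟨fun x hx => ?_, fun y hy => ?_⟩
  · have h1 : ContDiffAt ℝ ∞ T x.1 := (hT.contMDiffAt hx.1).contDiffAt
    exact (ContDiffAt.prodMap' h1 contDiffAt_id).contMDiffAt.contMDiffWithinAt
  · have h1 : ContDiffAt ℝ ∞ T.symm y.1 := (hT.contMDiffAt_symm hy.1).contDiffAt
    exact (ContDiffAt.prodMap' h1 contDiffAt_id).contMDiffAt.contMDiffWithinAt

end OpenPartialHomeomorph.IsSmoothChart

/-- The smooth charts `Φ` and `κ` exhibit `p` as the projection `B × C → B`. Here `Φ.target` need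
not be a product. -/
structure IsSubmersionChart (p : S → Q) (Φ : OpenPartialHomeomorph S (B × C))
    (κ : OpenPartialHomeomorph Q B) : Prop where
  smooth_dom : Φ.IsSmoothChart (E := F)
  smooth_cod : κ.IsSmoothChart (E := B)
  mem_source : ∀ t ∈ Φ.source, p t ∈ κ.source
  apply_eq : ∀ t ∈ Φ.source, κ (p t) = (Φ t).1

theorem Manifold.IsSubmersionAt.exists_chart [FiniteDimensional ℝ F] {p : S → Q} {s : S}
    (h : Manifold.IsSubmersionAt 𝓘(ℝ, F) 𝓘(ℝ, B) ∞ p s) :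
    ∃ (C : Type uF) (_ : NormedAddCommGroup C) (_ : NormedSpace ℝ C) (_ : FiniteDimensional ℝ C)
      (Φ : OpenPartialHomeomorph S (B × C)) (κ : OpenPartialHomeomorph Q B),
      IsSubmersionChart (F := F) p Φ κ ∧ s ∈ Φ.source := by
  obtain ⟨C, _, _, φ, κ, hs, -, hφ, hκ, hsub, e, he⟩ := h
  have : FiniteDimensional ℝ (B × C) := e.toLinearEquiv.finiteDimensional
  have : FiniteDimensional ℝ C :=
    Module.Finite.of_surjective (LinearMap.snd ℝ B C) LinearMap.snd_surjective
  refine ⟨C, _, _, this, φ.trans e.toHomeomorph.toOpenPartialHomeomorph, κ,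
    ⟨(OpenPartialHomeomorph.IsSmoothChart.of_mem_maximalAtlas hφ).trans
      (OpenPartialHomeomorph.IsSmoothChart.continuousLinearEquiv e),
      OpenPartialHomeomorph.IsSmoothChart.of_mem_maximalAtlas hκ, ?_, ?_⟩, ?_⟩
  · intro t ht
    exact hsub (by simpa using ht)
  · intro t ht
    have ht : t ∈ φ.source := by simpa using ht
    have h := he (x := φ t) (by simpa using φ.map_source ht)
    simpa [φ.left_inv ht] using h
  · simpa using hs

/-- An embedding is locally the inclusion `G → G × C`, with a prescribed chart of the source up to
restriction. The chart `Θ` meets the image of the embedding in the slice only, because the topology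
of the source is induced by the embedding. -/
theorem Manifold.IsSmoothEmbedding.exists_chart
    {E : Type uE} [NormedAddCommGroup E] [NormedSpace ℝ E] [FiniteDimensional ℝ E]
    {N : Type*} [TopologicalSpace N] [ChartedSpace E N] {ι : S → N}
    (hι : Manifold.IsSmoothEmbedding 𝓘(ℝ, F) 𝓘(ℝ, E) ∞ ι)
    {G : Type*} [NormedAddCommGroup G] [NormedSpace ℝ G] {Φ : OpenPartialHomeomorph S G}
    (hΦ : Φ.IsSmoothChart (E := F)) {s : S} (hs : s ∈ Φ.source) :
    ∃ (C : Type uE) (_ : NormedAddCommGroup C) (_ : NormedSpace ℝ C) (_ : FiniteDimensional ℝ C)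
      (Θ : OpenPartialHomeomorph N (G × C)), Θ.IsSmoothChart (E := E) ∧ ι s ∈ Θ.source ∧
      ∀ t, ι t ∈ Θ.source → t ∈ Φ.source ∧ Θ (ι t) = (Φ t, 0) := by
  obtain ⟨C, _, _, φ, θ, hsφ, hsθ, hφ, hθ, hsub, e, he⟩ := hι.isImmersion.isImmersionAt s
  have : FiniteDimensional ℝ (F × C) := e.symm.toLinearEquiv.finiteDimensional
  have : FiniteDimensional ℝ C :=
    Module.Finite.of_surjective (LinearMap.snd ℝ F C) LinearMap.snd_surjective
  obtain ⟨O, hO, hOs⟩ := hι.isEmbedding.isOpen_iff.mp (Φ.open_source.inter φ.open_source)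
  have hφ' := OpenPartialHomeomorph.IsSmoothChart.of_mem_maximalAtlas hφ
  have hθ' := OpenPartialHomeomorph.IsSmoothChart.of_mem_maximalAtlas hθ
  have key : ∀ t ∈ φ.source, e.symm (θ (ι t)) = (φ t, 0) := fun t ht => by
    have h := he (x := φ t) (by simpa using φ.map_source ht)
    rw [ContinuousLinearEquiv.symm_apply_eq]
    simpa [φ.left_inv ht] using h
  have hO' : ∀ t, ι t ∈ O ↔ t ∈ Φ.source ∩ φ.source := fun t => by
    rw [← hOs]
    rfl
  refine ⟨C, _, _, this, ((θ.restrOpen O hO).trans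
    e.symm.toHomeomorph.toOpenPartialHomeomorph).trans
    ((φ.symm.trans Φ).prod (OpenPartialHomeomorph.refl C)),
    ((hθ'.restrOpen hO).trans (.continuousLinearEquiv e.symm)).trans
      (hφ'.symm_trans hΦ).prod_refl, ?_, fun t ht => ?_⟩
  · have h1 : ι s ∈ O := (hO' s).mpr ⟨hs, hsφ⟩
    simp [hsθ, h1, key s hsφ, φ.map_source hsφ, φ.left_inv hsφ, hs]
  · have h1 : ι t ∈ O := by
      simp at ht
      exact ht.1.2
    have h2 := (hO' t).mp h1
    refine ⟨h2.1, ?_⟩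
    simp [key t h2.2, φ.left_inv h2.2]

end NormalForm

namespace IsSubmersionChart

variable {F : Type*} [NormedAddCommGroup F] [NormedSpace ℝ F]
  {S : Type*} [TopologicalSpace S] [ChartedSpace F S]
  {B : Type*} [NormedAddCommGroup B] [NormedSpace ℝ B]
  {Q : Type*} [TopologicalSpace Q] [ChartedSpace B Q]
  {C : Type*} [NormedAddCommGroup C] [NormedSpace ℝ C]
  {p : S → Q} {Φ : OpenPartialHomeomorph S (B × C)} {κ : OpenPartialHomeomorph Q B}
  (h : IsSubmersionChart (F := F) p Φ κ)

include h

theorem apply_symm {z : B × C} (hz : z ∈ Φ.target) : p (Φ.symm z) = κ.symm z.1 := by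
  have h1 := h.apply_eq _ (Φ.map_target hz)
  rw [Φ.right_inv hz] at h1
  rw [← h1, κ.left_inv (h.mem_source _ (Φ.map_target hz))]

theorem fst_mem_target {z : B × C} (hz : z ∈ Φ.target) : z.1 ∈ κ.target := by
  have h1 := h.apply_eq _ (Φ.map_target hz)
  rw [Φ.right_inv hz] at h1
  rw [← h1]
  exact κ.map_source (h.mem_source _ (Φ.map_target hz))

theorem eq_iff {s t : S} (hs : s ∈ Φ.source) (ht : t ∈ Φ.source) :
    p s = p t ↔ (Φ s).1 = (Φ t).1 := by
  rw [← h.apply_eq s hs, ← h.apply_eq t ht]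
  exact (κ.injOn.eq_iff (h.mem_source s hs) (h.mem_source t ht)).symm

theorem mfderiv_mfderiv_symm (hp : ContMDiff 𝓘(ℝ, F) 𝓘(ℝ, B) ∞ p) {z : B × C}
    (hz : z ∈ Φ.target) (v : B × C) :
    (mfderiv 𝓘(ℝ, F) 𝓘(ℝ, B) p (Φ.symm z) (mfderiv 𝓘(ℝ, B × C) 𝓘(ℝ, F) Φ.symm z v) : B) =
      mfderiv 𝓘(ℝ, B) 𝓘(ℝ, B) κ.symm z.1 v.1 := by
  have hΦ := (h.smooth_dom.contMDiffAt_symm hz).mdifferentiableAt (by simp)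
  have hκ := (h.smooth_cod.contMDiffAt_symm (h.fst_mem_target hz)).mdifferentiableAt (by simp)
  have e : p ∘ Φ.symm =ᶠ[𝓝 z] κ.symm ∘ Prod.fst := by
    filter_upwards [Φ.open_target.mem_nhds hz] with z' hz' using h.apply_symm hz'
  have hf : MDifferentiableAt 𝓘(ℝ, B × C) 𝓘(ℝ, B) (Prod.fst : B × C → B) z :=
    differentiableAt_fst.mdifferentiableAt
  have h1 := e.mfderiv_eq (I := 𝓘(ℝ, B × C)) (I' := 𝓘(ℝ, B))
  rw [mfderiv_comp z (hp.mdifferentiable (by simp) _) hΦ, mfderiv_comp z hκ hf,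
    mfderiv_eq_fderiv, fderiv_fst] at h1
  exact DFunLike.congr_fun h1 v

/-- The kernel of the differential of a submersion is the vertical space. -/
theorem mfderiv_eq_zero_iff (hp : ContMDiff 𝓘(ℝ, F) 𝓘(ℝ, B) ∞ p) [IsManifold 𝓘(ℝ, B) ∞ Q]
    {z : B × C} (hz : z ∈ Φ.target) (v : B × C) :
    (mfderiv 𝓘(ℝ, F) 𝓘(ℝ, B) p (Φ.symm z) (mfderiv 𝓘(ℝ, B × C) 𝓘(ℝ, F) Φ.symm z v) : B) = 0 ↔
      v.1 = 0 := by
  rw [h.mfderiv_mfderiv_symm hp hz]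
  have hi := (h.smooth_cod.bijective_mfderiv_symm (h.fst_mem_target hz)).1
  exact ⟨fun h0 => hi (h0.trans (map_zero _).symm), fun h0 => by rw [h0]; exact map_zero _⟩

/-- A map on a chart domain whose vertical derivatives vanish is locally constant along the fibres
of the submersion. -/
theorem eventually_eq_of_fderiv_vertical {V : Type*} [NormedAddCommGroup V] [NormedSpace ℝ V]
    {W : B × C → V} (hW : ∀ z ∈ Φ.target, DifferentiableAt ℝ W z)
    (hW' : ∀ z ∈ Φ.target, ∀ c : C, fderiv ℝ W z (0, c) = 0) {s : S} (hs : s ∈ Φ.source) :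
    ∀ᶠ t in 𝓝 s, p s = p t → W (Φ s) = W (Φ t) := by
  obtain ⟨ε, hε, hball⟩ := Metric.isOpen_iff.mp Φ.open_target (Φ s) (Φ.map_source hs)
  have hmem : ∀ c ∈ Metric.ball (Φ s).2 ε, ((Φ s).1, c) ∈ Φ.target := fun c hc => by
    refine hball ?_
    rw [← ball_prod_same]
    exact ⟨Metric.mem_ball_self hε, hc⟩
  have hd : ∀ c ∈ Metric.ball (Φ s).2 ε,
      HasFDerivAt (fun c => W ((Φ s).1, c)) (0 : C →L[ℝ] V) c := fun c hc => by
    have h1 : HasFDerivAt (fun c => W ((Φ s).1, c)) _ c :=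
      (hW _ (hmem c hc)).hasFDerivAt.comp c (hasFDerivAt_prodMk_right (𝕜 := ℝ) (Φ s).1 c)
    exact h1.congr_fderiv (ContinuousLinearMap.ext fun v => hW' _ (hmem c hc) v)
  have hpre : Φ ⁻¹' Metric.ball (Φ s) ε ∈ 𝓝 s :=
    (Φ.continuousAt hs).preimage_mem_nhds (Metric.ball_mem_nhds _ hε)
  filter_upwards [hpre, Φ.open_source.mem_nhds hs] with t ht hts hpt
  have h1 := (h.eq_iff hs hts).mp hpt
  have h2 : (Φ t).2 ∈ Metric.ball (Φ s).2 ε := by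
    rw [Set.mem_preimage, ← ball_prod_same] at ht
    exact ht.2
  have h3 := Metric.isOpen_ball.is_const_of_fderiv_eq_zero (𝕜 := ℝ)
    (convex_ball (Φ s).2 ε).isPreconnected
    (fun c hc => (hd c hc).differentiableAt.differentiableWithinAt)
    (fun c hc => (hd c hc).fderiv) (Metric.mem_ball_self hε) h2
  have h4 : Φ t = ((Φ s).1, (Φ t).2) := Prod.ext h1.symm rfl
  rw [h4]
  exact h3

end IsSubmersionChart

/-! ### Regular foliations -/

/-- A smooth map does not raise the Hausdorff dimension above the dimension of its source. -/
theorem dimH_image_le_finrank {V : Type*} [NormedAddCommGroup V] [NormedSpace ℝ V]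
    [FiniteDimensional ℝ V] {L : Type*} [TopologicalSpace L] [ChartedSpace V L]
    [IsManifold 𝓘(ℝ, V) ∞ L] [SecondCountableTopology L] {C : Type*} [NormedAddCommGroup C]
    [NormedSpace ℝ C] {u : L → C} {A : Set L}
    (hu : ∀ l ∈ A, ContMDiffAt 𝓘(ℝ, V) 𝓘(ℝ, C) ∞ u l) :
    dimH (u '' A) ≤ Module.finrank ℝ V := by
  have key : ∀ l ∈ A, ∃ U ∈ 𝓝 l, dimH (u '' U) ≤ Module.finrank ℝ V := fun l hl => by
    have hΘ := OpenPartialHomeomorph.IsSmoothChart.chartAt (E := V) l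
    have hsrc := mem_chart_source V l
    have h1 : ContDiffAt ℝ ∞ (u ∘ (chartAt V l).symm) (chartAt V l l) := by
      have h2 := hΘ.contMDiffAt_symm ((chartAt V l).map_source hsrc)
      refine (ContMDiffAt.comp (g := u) _ ?_ h2).contDiffAt
      rw [(chartAt V l).left_inv hsrc]
      exact hu l hl
    obtain ⟨W, hW, hWd⟩ := (h1.of_le (m := 1) (by simp)).contDiffOn le_rfl (by simp)
    obtain ⟨ε, hε, hball⟩ := Metric.mem_nhds_iff.mp hW
    refine ⟨(chartAt V l).source ∩ chartAt V l ⁻¹' Metric.ball (chartAt V l l) ε,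
      Filter.inter_mem ((chartAt V l).open_source.mem_nhds hsrc)
        (((chartAt V l).continuousAt hsrc).preimage_mem_nhds (Metric.ball_mem_nhds _ hε)), ?_⟩
    refine le_trans (dimH_mono ?_) ((hWd.mono hball).dimH_image_le (convex_ball _ ε) subset_rfl
      |>.trans ?_)
    · rintro _ ⟨x, hx, rfl⟩
      exact ⟨chartAt V l x, hx.2, by simp [(chartAt V l).left_inv hx.1]⟩
    · refine (dimH_mono (Set.subset_univ _)).trans ?_
      rw [Real.dimH_univ_eq_finrank]
  choose! U hU hUd using key
  obtain ⟨t, htA, htc, hcov⟩ := TopologicalSpace.countable_cover_nhdsWithin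
    (s := A) (f := U) fun l hl => mem_nhdsWithin_of_mem_nhds (hU l hl)
  refine (dimH_mono (t := ⋃ l ∈ t, u '' U l) ?_).trans ?_
  · rw [← Set.image_iUnion₂]
    exact Set.image_mono hcov
  · rw [dimH_bUnion htc]
    exact iSup₂_le fun l hl => hUd l (htA hl)

namespace IsFoliationBy

universe u

variable {F : Type*} [NormedAddCommGroup F] [NormedSpace ℝ F]
  {S : Type u} [TopologicalSpace S] [ChartedSpace F S]
  {D : ∀ s : S, Submodule ℝ (TangentSpace 𝓘(ℝ, F) s)} {r : ℕ} {K : Setoid S}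
  (hK : IsFoliationBy D r K)

include hK

/-- A function on a foliated manifold that is locally constant along the leaves is constant on each
leaf, since leaves are connected. -/
theorem eq_of_rel {X : Type*} {P : S → X}
    (hP : ∀ s, ∀ᶠ t in 𝓝 s, Quotient.mk K s = Quotient.mk K t → P s = P t) {s t : S}
    (hst : K s t) : P s = P t := by
  obtain ⟨L, _, _, _, _, _, j, hj, -, hrange, -⟩ := hK.exists_leaf s
  have hrel : ∀ l, K s (j l) := fun l => by
    have : j l ∈ Set.range j := ⟨l, rfl⟩
    rwa [hrange] at this
  have hloc : IsLocallyConstant (P ∘ j) := by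
    rw [IsLocallyConstant.iff_eventually_eq]
    intro l
    filter_upwards [hj.contMDiff.continuous.continuousAt.eventually (hP (j l))] with l' hl'
    exact (hl' (Quotient.sound (K.trans (K.symm (hrel l)) (hrel l')))).symm
  obtain ⟨l, rfl⟩ : s ∈ Set.range j := by
    rw [hrange]
    exact K.refl s
  obtain ⟨l', rfl⟩ : t ∈ Set.range j := by
    rw [hrange]
    exact hst
  exact hloc.apply_eq_of_preconnectedSpace l l'

variable [IsManifold 𝓘(ℝ, F) ∞ S] {B : Type*} [NormedAddCommGroup B] [NormedSpace ℝ B]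
  [ChartedSpace B (Quotient K)] [IsManifold 𝓘(ℝ, B) ∞ (Quotient K)]

omit [IsManifold 𝓘(ℝ, F) ∞ S] [IsManifold 𝓘(ℝ, B) ∞ (Quotient K)] in
/-- The leaves are mapped to points, so the foliated distribution is vertical. -/
theorem le_ker_mfderiv (hp : ContMDiff 𝓘(ℝ, F) 𝓘(ℝ, B) ∞ (Quotient.mk K)) (s : S) :
    D s ≤ LinearMap.ker (mfderiv 𝓘(ℝ, F) 𝓘(ℝ, B) (Quotient.mk K) s).toLinearMap := by
  obtain ⟨L, _, _, _, _, _, j, hj, -, hrange, hD⟩ := hK.exists_leaf s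
  obtain ⟨l, rfl⟩ : s ∈ Set.range j := by
    rw [hrange]
    exact K.refl s
  rw [← hD l]
  rintro _ ⟨v, rfl⟩
  have hconst : (Quotient.mk K ∘ j) = fun _ => Quotient.mk K (j l) := by
    funext l'
    refine (Quotient.sound ?_).symm
    have : j l' ∈ Set.range j := ⟨l', rfl⟩
    rwa [hrange] at this
  have h1 := mfderiv_comp l (hp.mdifferentiable (by simp) (j l))
    (hj.contMDiff.mdifferentiable (by simp) l)
  have h2 : mfderiv 𝓘(ℝ, EuclideanSpace ℝ (Fin r)) 𝓘(ℝ, B) (Quotient.mk K ∘ j) l v = (0 : B) := by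
    rw [hconst, mfderiv_const]
    rfl
  rw [h1] at h2
  exact LinearMap.mem_ker.mpr h2

/-- The distribution is the whole vertical space of the projection onto the leaf space: a fibre is a
single leaf, hence a smooth image of a second countable manifold of dimension `r`, and such an image
contains an open set of the vertical model space only if the dimension of the latter is at most
`r`. -/
theorem eq_ker_mfderiv [FiniteDimensional ℝ F]
    (hp : Manifold.IsSubmersion 𝓘(ℝ, F) 𝓘(ℝ, B) ∞ (Quotient.mk K)) (s : S) :
    D s = LinearMap.ker (mfderiv 𝓘(ℝ, F) 𝓘(ℝ, B) (Quotient.mk K) s).toLinearMap := by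
  have : FiniteDimensional ℝ (TangentSpace 𝓘(ℝ, F) s) := inferInstanceAs (FiniteDimensional ℝ F)
  refine Submodule.eq_of_le_of_finrank_le (hK.le_ker_mfderiv hp.contMDiff s) ?_
  rw [hK.rank_eq]
  obtain ⟨C, _, _, _, Φ, κ, h, hs⟩ := (hp.isSubmersionAt s).exists_chart
  obtain ⟨z, hz, rfl⟩ : ∃ z ∈ Φ.target, Φ.symm z = s := ⟨Φ s, Φ.map_source hs, Φ.left_inv hs⟩
  -- The kernel is the image of the vertical space `C`.
  have h1 : Module.finrank ℝ
      (LinearMap.ker (mfderiv 𝓘(ℝ, F) 𝓘(ℝ, B) (Quotient.mk K) (Φ.symm z)).toLinearMap) ≤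
      Module.finrank ℝ C := by
    let T : C →ₗ[ℝ] TangentSpace 𝓘(ℝ, F) (Φ.symm z) :=
      (mfderiv 𝓘(ℝ, B × C) 𝓘(ℝ, F) Φ.symm z).toLinearMap.comp (LinearMap.inr ℝ B C)
    refine (Submodule.finrank_mono (t := LinearMap.range T) fun v hv => ?_).trans
      (LinearMap.finrank_range_le T)
    obtain ⟨w, rfl⟩ := (h.smooth_dom.bijective_mfderiv_symm hz).2 v
    have hw : w.1 = 0 := (h.mfderiv_eq_zero_iff hp.contMDiff hz w).mp hv
    have hw' : ((0 : B), w.2) = w := Prod.ext hw.symm rfl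
    exact ⟨w.2, congrArg (mfderiv 𝓘(ℝ, B × C) 𝓘(ℝ, F) Φ.symm z) hw'⟩
  refine h1.trans ?_
  -- The slice of the fibre in the chart is open in `C`, but it is also covered by the leaf.
  obtain ⟨L, _, _, _, _, _, j, hj, -, hrange, -⟩ := hK.exists_leaf (Φ.symm z)
  have h2 := dimH_image_le_finrank (V := EuclideanSpace ℝ (Fin r)) (L := L) (C := C)
    (u := fun l => (Φ (j l)).2) (A := j ⁻¹' Φ.source) fun l hl =>
      (contDiff_snd.contMDiff (n := ∞)).contMDiffAt.comp l
        ((h.smooth_dom.contMDiffAt hl).comp l hj.contMDiff.contMDiffAt)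
  have hslice : IsOpen {c : C | (z.1, c) ∈ Φ.target} :=
    Φ.open_target.preimage (Continuous.prodMk_right z.1)
  have h3 : {c : C | (z.1, c) ∈ Φ.target} ⊆ (fun l => (Φ (j l)).2) '' (j ⁻¹' Φ.source) := by
    intro c hc
    have hrel : Φ.symm (z.1, c) ∈ Set.range j := by
      rw [hrange]
      exact Quotient.exact ((h.apply_symm hz).trans (h.apply_symm hc).symm)
    obtain ⟨l, hl⟩ := hrel
    refine ⟨l, ?_, ?_⟩
    · rw [Set.mem_preimage, hl]
      exact Φ.map_target hc
    · simp only [hl, Φ.right_inv hc]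
  have h4 := (dimH_mono h3).trans h2
  rw [Real.dimH_of_nonempty_interior ⟨z.2, by rwa [hslice.interior_eq]⟩] at h4
  simpa using h4

end IsFoliationBy

/-! ### The symplectic form of the leaf space -/

section Reduction

universe u

variable {E : Type*} [NormedAddCommGroup E] [NormedSpace ℝ E] [FiniteDimensional ℝ E]
  {F : Type*} [NormedAddCommGroup F] [NormedSpace ℝ F] [FiniteDimensional ℝ F]
  {B : Type*} [NormedAddCommGroup B] [NormedSpace ℝ B] [FiniteDimensional ℝ B]
  {N : Type*} [TopologicalSpace N] [ChartedSpace E N] [IsManifold 𝓘(ℝ, E) ∞ N]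
  {Ω : SymplecticForm E N}
  {S : Type u} [TopologicalSpace S] [ChartedSpace F S] [IsManifold 𝓘(ℝ, F) ∞ S] {ι : S → N}
  (hι : ContMDiff 𝓘(ℝ, F) 𝓘(ℝ, E) ∞ ι) {r : ℕ} {K : Setoid S}
  (hK : IsFoliationBy (TwoForm.ker (TwoForm.pullback (F := F) ι Ω.form)) r K)
  [ChartedSpace B (Quotient K)] [IsManifold 𝓘(ℝ, B) ∞ (Quotient K)]
  (hp : Manifold.IsSubmersion 𝓘(ℝ, F) 𝓘(ℝ, B) ∞ (Quotient.mk K))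

include hι hK hp

namespace IsSubmersionChart

variable {C : Type*} [NormedAddCommGroup C] [NormedSpace ℝ C]
  {Φ : OpenPartialHomeomorph S (B × C)} {κ : OpenPartialHomeomorph (Quotient K) B}
  (h : IsSubmersionChart (F := F) (Quotient.mk K) Φ κ)

include h

omit [FiniteDimensional ℝ E] [FiniteDimensional ℝ F] [FiniteDimensional ℝ B]
  [IsManifold 𝓘(ℝ, E) ∞ N] [IsManifold 𝓘(ℝ, F) ∞ S] [IsManifold 𝓘(ℝ, B) ∞ (Quotient K)] hK hp in
theorem pullback_apply_chart {z : B × C} (hz : z ∈ Φ.target) (v w : B × C) :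
    TwoForm.pullback (F := B × C) (ι ∘ Φ.symm) Ω.form z ![v, w] =
      TwoForm.pullback (F := F) ι Ω.form (Φ.symm z) ![mfderiv 𝓘(ℝ, B × C) 𝓘(ℝ, F) Φ.symm z v,
        mfderiv 𝓘(ℝ, B × C) 𝓘(ℝ, F) Φ.symm z w] := by
  rw [← TwoForm.pullback_pullback (F := F) Ω.form (hι.mdifferentiable (by simp) _)
    ((h.smooth_dom.contMDiffAt_symm hz).mdifferentiableAt (by simp))]
  exact TwoForm.pullback_apply Φ.symm (TwoForm.pullback (F := F) ι Ω.form) z v w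

omit [FiniteDimensional ℝ E] [FiniteDimensional ℝ B] [IsManifold 𝓘(ℝ, E) ∞ N] in
theorem pullback_apply_vertical {z : B × C} (hz : z ∈ Φ.target) (c : C) (w : B × C) :
    TwoForm.pullback (F := B × C) (ι ∘ Φ.symm) Ω.form z ![((0 : B), c), w] = 0 := by
  rw [h.pullback_apply_chart hι hz]
  have h1 : mfderiv 𝓘(ℝ, B × C) 𝓘(ℝ, F) Φ.symm z ((0 : B), c) ∈
      TwoForm.ker (TwoForm.pullback (F := F) ι Ω.form) (Φ.symm z) := by
    rw [hK.eq_ker_mfderiv hp]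
    exact LinearMap.mem_ker.mpr ((h.mfderiv_eq_zero_iff hp.contMDiff hz _).mpr rfl)
  exact LinearMap.congr_fun (LinearMap.mem_ker.mp h1) _

variable [FiniteDimensional ℝ C]

omit [FiniteDimensional ℝ F] [FiniteDimensional ℝ B] [IsManifold 𝓘(ℝ, F) ∞ S]
  [IsManifold 𝓘(ℝ, B) ∞ (Quotient K)] hK hp in
theorem contDiffAt_pullback_chart [FiniteDimensional ℝ B] {z : B × C} (hz : z ∈ Φ.target) :
    ContDiffAt (E := B × C) (F := (B × C) [⋀^Fin 2]→L[ℝ] ℝ) ℝ ∞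
      (TwoForm.pullback (F := B × C) (ι ∘ Φ.symm) Ω.form) z :=
  TwoForm.contDiffAt_pullback Ω.smooth
    (hι.contMDiffAt.comp z (h.smooth_dom.contMDiffAt_symm hz))

theorem eventually_pullback_eq {s : S} (hs : s ∈ Φ.source) :
    ∀ᶠ t in 𝓝 s, Quotient.mk K s = Quotient.mk K t →
      (TwoForm.pullback (F := B × C) (ι ∘ Φ.symm) Ω.form (Φ s) : (B × C) [⋀^Fin 2]→L[ℝ] ℝ) =
        TwoForm.pullback (F := B × C) (ι ∘ Φ.symm) Ω.form (Φ t) := by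
  have hd : ∀ z ∈ Φ.target, DifferentiableAt (E := B × C) (F := (B × C) [⋀^Fin 2]→L[ℝ] ℝ) ℝ
      (TwoForm.pullback (F := B × C) (ι ∘ Φ.symm) Ω.form) z := fun z hz =>
    (h.contDiffAt_pullback_chart hι hz).differentiableAt (by simp)
  refine h.eventually_eq_of_fderiv_vertical hd (fun z hz c => ?_) hs
  refine TwoForm.fderiv_vertical_eq_zero (hd z hz) (TwoForm.extDeriv_pullback_eq_zero Ω.smooth
    Ω.closed (hι.contMDiffAt.comp z (h.smooth_dom.contMDiffAt_symm hz))) ?_ c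
  filter_upwards [Φ.open_target.mem_nhds hz] with z' hz' c v
  exact h.pullback_apply_vertical hι hK hp hz' c v

end IsSubmersionChart

omit [FiniteDimensional ℝ E] [FiniteDimensional ℝ F] [FiniteDimensional ℝ B]
  [IsManifold 𝓘(ℝ, E) ∞ N] [IsManifold 𝓘(ℝ, F) ∞ S] [IsManifold 𝓘(ℝ, B) ∞ (Quotient K)] hι hK in
theorem surjective_mfderiv_mk [FiniteDimensional ℝ F] [IsManifold 𝓘(ℝ, F) ∞ S]
    [IsManifold 𝓘(ℝ, B) ∞ (Quotient K)] (s : S) :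
    Function.Surjective (mfderiv 𝓘(ℝ, F) 𝓘(ℝ, B) (Quotient.mk K) s) := by
  obtain ⟨C, _, _, _, Φ, κ, h, hs⟩ := (hp.isSubmersionAt s).exists_chart
  obtain ⟨z, hz, rfl⟩ : ∃ z ∈ Φ.target, Φ.symm z = s := ⟨Φ s, Φ.map_source hs, Φ.left_inv hs⟩
  intro b
  obtain ⟨v, hv⟩ := (h.smooth_cod.bijective_mfderiv_symm (h.fst_mem_target hz)).2 b
  exact ⟨mfderiv 𝓘(ℝ, B × C) 𝓘(ℝ, F) Φ.symm z (v, (0 : C)),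
    (h.mfderiv_mfderiv_symm hp.contMDiff hz (v, 0)).trans hv⟩

/-- The form `ω_c` at the points of a leaf descends to one and the same form on the tangent space of
the leaf space. -/
theorem exists_reduced_form (b : Quotient K) : ∃ η : B [⋀^Fin 2]→L[ℝ] ℝ, ∀ s : S,
    Quotient.mk K s = b → ∀ v w : F, η ![mfderiv 𝓘(ℝ, F) 𝓘(ℝ, B) (Quotient.mk K) s v,
      mfderiv 𝓘(ℝ, F) 𝓘(ℝ, B) (Quotient.mk K) s w] =
        TwoForm.pullback (F := F) ι Ω.form s ![v, w] := by
  obtain ⟨s₀, rfl⟩ := Quotient.exists_rep b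
  let A : F →L[ℝ] B := mfderiv 𝓘(ℝ, F) 𝓘(ℝ, B) (Quotient.mk K) s₀
  obtain ⟨R, hR⟩ := A.toLinearMap.exists_rightInverse_of_surjective
    (LinearMap.range_eq_top.mpr (surjective_mfderiv_mk hp s₀))
  let ω₀ : F [⋀^Fin 2]→L[ℝ] ℝ := TwoForm.pullback (F := F) ι Ω.form s₀
  have hker : ∀ v w : TangentSpace 𝓘(ℝ, F) s₀, A v = 0 → ω₀ ![v, w] = 0 := fun v w hv => by
    have h1 : v ∈ TwoForm.ker (TwoForm.pullback (F := F) ι Ω.form) s₀ := by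
      rw [hK.eq_ker_mfderiv hp]
      exact LinearMap.mem_ker.mpr hv
    exact LinearMap.congr_fun (LinearMap.mem_ker.mp h1) w
  have hRA : ∀ v w : F, ω₀ ![R (A v), w] = ω₀ ![v, w] := fun v w => by
    have h1 : A (R (A v) - v) = 0 := by
      rw [map_sub, sub_eq_zero]
      exact LinearMap.congr_fun hR (A v)
    have h2 := hker _ w h1
    rw [← TwoForm.bilin_apply, map_sub, _root_.sub_apply, sub_eq_zero] at h2
    simpa using h2
  let η : B [⋀^Fin 2]→L[ℝ] ℝ := ω₀.compContinuousLinearMap R.toContinuousLinearMap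
  refine ⟨η, fun s hs => ?_⟩
  let P : S → Prop := fun s => ∀ v w : F, η ![mfderiv 𝓘(ℝ, F) 𝓘(ℝ, B) (Quotient.mk K) s v,
      mfderiv 𝓘(ℝ, F) 𝓘(ℝ, B) (Quotient.mk K) s w] =
        TwoForm.pullback (F := F) ι Ω.form s ![v, w]
  have hP₀ : P s₀ := fun v w => by
    refine (TwoForm.compContinuousLinearMap_apply_pair ω₀ _ (A v) (A w)).trans ?_
    change ω₀ ![R (A v), R (A w)] = ω₀ ![v, w]
    rw [hRA, TwoForm.apply_swap, hRA, ← TwoForm.apply_swap]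
  have hP : P s₀ = P s := by
    refine hK.eq_of_rel (fun s => ?_) (Quotient.exact hs.symm)
    obtain ⟨C, _, _, _, Φ, κ, h, hs⟩ := (hp.isSubmersionAt s).exists_chart
    -- In the chart the condition depends only on the point of the leaf space and on the local
    -- representative of the form, both of which are locally constant along the fibre.
    have hiff : ∀ t ∈ Φ.source, P t ↔ ∀ v w : B × C,
        η ![mfderiv 𝓘(ℝ, B) 𝓘(ℝ, B) κ.symm (Φ t).1 v.1, mfderiv 𝓘(ℝ, B) 𝓘(ℝ, B) κ.symm (Φ t).1 w.1]
        = TwoForm.pullback (F := B × C) (ι ∘ Φ.symm) Ω.form (Φ t) ![v, w] := by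
      intro t ht
      obtain ⟨z, hz, rfl⟩ : ∃ z ∈ Φ.target, Φ.symm z = t := ⟨Φ t, Φ.map_source ht, Φ.left_inv ht⟩
      rw [Φ.right_inv hz]
      have hm := h.mfderiv_mfderiv_symm hp.contMDiff hz
      constructor
      · intro hP v w
        exact (congrArg₂ (fun a b : B => η ![a, b]) (hm v) (hm w)).symm.trans
          ((hP _ _).trans (h.pullback_apply_chart hι hz v w).symm)
      · intro hQ v w
        obtain ⟨v, rfl⟩ := (h.smooth_dom.bijective_mfderiv_symm hz).2 v
        obtain ⟨w, rfl⟩ := (h.smooth_dom.bijective_mfderiv_symm hz).2 w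
        exact (congrArg₂ (fun a b : B => η ![a, b]) (hm v) (hm w)).trans
          ((hQ v w).trans (h.pullback_apply_chart hι hz v w))
    filter_upwards [h.eventually_pullback_eq hι hK hp hs, Φ.open_source.mem_nhds hs]
      with t ht hts he
    rw [eq_iff_iff, hiff s hs, hiff t hts, (h.eq_iff hs hts).mp he]
    exact ⟨fun hQ v w => (hQ v w).trans (DFunLike.congr_fun (ht he) _),
      fun hQ v w => (hQ v w).trans (DFunLike.congr_fun (ht he) _).symm⟩
  exact (eq_iff_iff.mp hP).mp hP₀

/-- The 2-form on the leaf space whose pullback is the restriction of `Ω` to `S`. -/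
noncomputable def reducedForm : TwoForm B (Quotient K) := fun b =>
  (exists_reduced_form hι hK hp b).choose

theorem pullback_reducedForm : TwoForm.pullback (F := F) (Quotient.mk K) (reducedForm hι hK hp) =
    TwoForm.pullback (F := F) ι Ω.form := by
  funext s
  refine TwoForm.ext_of_apply (G := F) fun v w => ?_
  exact (TwoForm.pullback_apply (Quotient.mk K) (reducedForm hι hK hp) s v w).trans
    ((exists_reduced_form hι hK hp (Quotient.mk K s)).choose_spec s rfl v w)

omit [FiniteDimensional ℝ B] [IsManifold 𝓘(ℝ, E) ∞ N] hι hK in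
/-- A form on the leaf space is determined by its pullback. -/
theorem eq_of_pullback_eq {η η' : TwoForm B (Quotient K)}
    (h : TwoForm.pullback (F := F) (Quotient.mk K) η =
      TwoForm.pullback (F := F) (Quotient.mk K) η') : η = η' := by
  funext b
  obtain ⟨s, rfl⟩ := Quotient.exists_rep b
  refine TwoForm.ext_of_apply (G := B) fun v w => ?_
  obtain ⟨v, rfl⟩ := surjective_mfderiv_mk hp s v
  obtain ⟨w, rfl⟩ := surjective_mfderiv_mk hp s w
  exact (TwoForm.pullback_apply (Quotient.mk K) η s v w).symm.trans
    ((DFunLike.congr_fun (congrFun h s) ![v, w]).trans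
      (TwoForm.pullback_apply (Quotient.mk K) η' s v w))

/-- The local representatives of the reduced form are pullbacks of `Ω` along local sections of the
projection onto the leaf space. -/
theorem inChart_reducedForm_eventuallyEq (x₀ : Quotient K) {y : B}
    (hy : y ∈ (extChartAt 𝓘(ℝ, B) x₀).target) :
    ∃ g : B → N, ContMDiffAt 𝓘(ℝ, B) 𝓘(ℝ, E) ∞ g y ∧
      TwoForm.inChart (reducedForm hι hK hp) x₀ =ᶠ[𝓝 y] TwoForm.pullback (F := B) g Ω.form := by
  have hχ := OpenPartialHomeomorph.IsSmoothChart.chartAt (E := B) x₀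
  set χ := chartAt B x₀ with hχdef
  have hyχ : y ∈ χ.target := by simpa using hy
  obtain ⟨s, hs⟩ := Quotient.exists_rep (χ.symm y)
  obtain ⟨C, _, _, _, Φ, κ, h, hsΦ⟩ := (hp.isSubmersionAt s).exists_chart
  let m : B → B × C := fun z => (κ (χ.symm z), (Φ s).2)
  have hκs : χ.symm y ∈ κ.source := hs ▸ h.mem_source s hsΦ
  have hmy : m y = Φ s := Prod.ext
    ((congrArg κ hs.symm).trans (h.apply_eq s hsΦ)) rfl
  have hms : ∀ z ∈ χ.target, χ.symm z ∈ κ.source → ContMDiffAt 𝓘(ℝ, B) 𝓘(ℝ, B × C) ∞ m z :=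
    fun z hz hz' => by
      have h1 := (h.smooth_cod.contMDiffAt hz').comp z (hχ.contMDiffAt_symm hz)
      exact (ContDiffAt.prodMk h1.contDiffAt contDiffAt_const).contMDiffAt
  have hmsy := hms y hyχ hκs
  have hmem : ∀ᶠ z in 𝓝 y, z ∈ χ.target ∧ χ.symm z ∈ κ.source ∧ m z ∈ Φ.target := by
    have h1 : m y ∈ Φ.target := by
      rw [hmy]
      exact Φ.map_source hsΦ
    filter_upwards [χ.open_target.mem_nhds hyχ, (χ.continuousAt_symm hyχ).preimage_mem_nhds
      (κ.open_source.mem_nhds hκs), hmsy.continuousAt.preimage_mem_nhds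
        (Φ.open_target.mem_nhds h1)] with z hz hz' hz''
    exact ⟨hz, hz', hz''⟩
  have hτ : ∀ z, z ∈ χ.target ∧ χ.symm z ∈ κ.source ∧ m z ∈ Φ.target →
      ContMDiffAt 𝓘(ℝ, B) 𝓘(ℝ, F) ∞ (Φ.symm ∘ m) z := fun z hz =>
    (h.smooth_dom.contMDiffAt_symm hz.2.2).comp z (hms z hz.1 hz.2.1)
  have hsec : ∀ z, z ∈ χ.target ∧ χ.symm z ∈ κ.source ∧ m z ∈ Φ.target →
      Quotient.mk K ((Φ.symm ∘ m) z) = χ.symm z := fun z hz =>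
    (h.apply_symm hz.2.2).trans (κ.left_inv hz.2.1)
  refine ⟨ι ∘ (Φ.symm ∘ m), hι.contMDiffAt.comp y (hτ y hmem.self_of_nhds), ?_⟩
  filter_upwards [hmem.eventually_nhds] with z hz
  have hτz := (hτ z hz.self_of_nhds).mdifferentiableAt (by simp)
  rw [← TwoForm.pullback_pullback (F := F) Ω.form (hι.mdifferentiable (by simp) _) hτz,
    ← pullback_reducedForm hι hK hp, TwoForm.pullback_pullback (F := F) _
      (hp.contMDiff.mdifferentiable (by simp) _) hτz]
  exact TwoForm.pullback_congr _ (hz.mono fun z' hz' => (hsec z' hz').symm)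

/-- The symplectic form of the leaf space. It is smooth and closed because it is locally the
pullback of `Ω` along a section, and nondegenerate because the whole kernel of the restricted form
has been divided out. -/
noncomputable def reducedSymplecticForm : SymplecticForm B (Quotient K) where
  form := reducedForm hι hK hp
  smooth x₀ y hy := by
    obtain ⟨g, hg, he⟩ := inChart_reducedForm_eventuallyEq hι hK hp x₀ hy
    exact (ContDiffAt.congr_of_eventuallyEq
      (TwoForm.contDiffAt_pullback Ω.smooth hg) he).contDiffWithinAt
  closed x₀ y hy := by
    obtain ⟨g, hg, he⟩ := inChart_reducedForm_eventuallyEq hι hK hp x₀ hy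
    rw [he.extDeriv_eq]
    exact TwoForm.extDeriv_pullback_eq_zero Ω.smooth Ω.closed hg
  nondegenerate b := by
    obtain ⟨s, rfl⟩ := Quotient.exists_rep b
    refine (Submodule.eq_bot_iff _).mpr fun v hv => ?_
    obtain ⟨v, rfl⟩ := surjective_mfderiv_mk hp s v
    have h1 : v ∈ TwoForm.ker (TwoForm.pullback (F := F) ι Ω.form) s := by
      refine LinearMap.mem_ker.mpr (LinearMap.ext fun w => ?_)
      change TwoForm.pullback (F := F) ι Ω.form s ![v, w] = 0
      rw [← pullback_reducedForm hι hK hp]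
      exact (TwoForm.pullback_apply (Quotient.mk K) (reducedForm hι hK hp) s v w).trans
        (LinearMap.congr_fun (LinearMap.mem_ker.mp hv) _)
    rw [hK.eq_ker_mfderiv hp] at h1
    exact LinearMap.mem_ker.mp h1

theorem pullback_eq_iff (Ω' : SymplecticForm B (Quotient K)) :
    TwoForm.pullback (F := F) (Quotient.mk K) Ω'.form = TwoForm.pullback (F := F) ι Ω.form ↔
      Ω' = reducedSymplecticForm hι hK hp := by
  rw [← pullback_reducedForm hι hK hp, SymplecticForm.ext_iff]
  exact ⟨fun h => eq_of_pullback_eq hp h, fun h => by rw [h]; rfl⟩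

end Reduction

/-! ### Gluing functions with prescribed differentials along a closed set -/

section Glue

variable {E : Type*} [NormedAddCommGroup E] [NormedSpace ℝ E]
  {N : Type*} [TopologicalSpace N] [ChartedSpace E N]

theorem HasMFDerivAt.finset_sum {α : Type*} {f : α → N → ℝ} {x : N}
    {f' : α → E →L[ℝ] ℝ} {I : Finset α}
    (h : ∀ i ∈ I, HasMFDerivAt 𝓘(ℝ, E) 𝓘(ℝ, ℝ) (f i) x (f' i)) :
    HasMFDerivAt 𝓘(ℝ, E) 𝓘(ℝ, ℝ) (fun y => ∑ i ∈ I, f i y) x (∑ i ∈ I, f' i : E →L[ℝ] ℝ) := by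
  classical
  induction I using Finset.induction_on with
  | empty =>
    refine (hasMFDerivAt_const (0 : ℝ) x).congr_of_eventuallyEq (.of_forall fun y => ?_)
    exact Finset.sum_empty
  | insert i I hi ih =>
    have h1 := (h i (Finset.mem_insert_self i I)).add
      (ih fun j hj => h j (Finset.mem_insert_of_mem hj))
    refine (h1.congr_of_eventuallyEq (.of_forall fun y => ?_)).congr_mfderiv ?_
    · exact Finset.sum_insert hi
    · exact (Finset.sum_insert (f := f') hi).symm

/-- Local functions with given values on a closed set `Z` and with differentials in given linear
subspaces at the points of `Z` can be glued: the differentials of the functions of a partition of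
unity drop out, because all the local functions have the same value at a point of `Z`. -/
theorem exists_contMDiffMap_glue [FiniteDimensional ℝ E] [IsManifold 𝓘(ℝ, E) ∞ N] [T2Space N]
    [SecondCountableTopology N] {Z : Set N} (hZ : IsClosed Z) (c : N → ℝ)
    (H : N → Submodule ℝ (E →L[ℝ] ℝ))
    (hloc : ∀ x ∈ Z, ∃ (U : Set N) (f : N → ℝ), IsOpen U ∧ x ∈ U ∧
      ContMDiffOn 𝓘(ℝ, E) 𝓘(ℝ, ℝ) ∞ f U ∧
      ∀ y ∈ U ∩ Z, f y = c y ∧ (mfderiv 𝓘(ℝ, E) 𝓘(ℝ, ℝ) f y : E →L[ℝ] ℝ) ∈ H y) :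
    ∃ f : C^∞⟮𝓘(ℝ, E), N; ℝ⟯, ∀ y ∈ Z,
      f y = c y ∧ (mfderiv 𝓘(ℝ, E) 𝓘(ℝ, ℝ) f y : E →L[ℝ] ℝ) ∈ H y := by
  have hloc' : ∀ x : N, ∃ (U : Set N) (f : N → ℝ), IsOpen U ∧ x ∈ U ∧
      ContMDiffOn 𝓘(ℝ, E) 𝓘(ℝ, ℝ) ∞ f U ∧
      ∀ y ∈ U ∩ Z, f y = c y ∧ (mfderiv 𝓘(ℝ, E) 𝓘(ℝ, ℝ) f y : E →L[ℝ] ℝ) ∈ H y := fun x => by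
    by_cases hx : x ∈ Z
    · exact hloc x hx
    · exact ⟨Zᶜ, 0, hZ.isOpen_compl, hx, contMDiffOn_const, fun y hy => absurd hy.2 hy.1⟩
  choose U f hU hxU hf hfU using hloc'
  have : LocallyCompactSpace N := ChartedSpace.locallyCompactSpace E N
  obtain ⟨ρ, hρ⟩ := SmoothPartitionOfUnity.exists_isSubordinate 𝓘(ℝ, E) isClosed_univ U hU
    fun x _ => Set.mem_iUnion_of_mem x (hxU x)
  have hsm : ContMDiff 𝓘(ℝ, E) 𝓘(ℝ, ℝ) ∞ fun x => ∑ᶠ i, ρ i x • f i x :=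
    hρ.contMDiff_finsum_smul hU hf
  refine ⟨⟨_, hsm⟩, fun y hy => ?_⟩
  have hI : ∀ i ∈ ρ.fintsupport y, y ∈ U i := fun i hi =>
    hρ i ((ρ.mem_fintsupport_iff y i).mp hi)
  have hsum : (fun x => ∑ᶠ i, ρ i x • f i x) =ᶠ[𝓝 y]
      fun x => ∑ i ∈ ρ.fintsupport y, (ρ i * f i) x := by
    filter_upwards [ρ.eventually_finsupport_subset y] with x hx
    rw [← ρ.sum_finsupport_smul_eq_finsum]
    refine Finset.sum_subset hx fun i _ hi => ?_
    have h0 : ρ i x = 0 := by simpa using hi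
    simp [h0]
  have hone : (fun x => ∑ i ∈ ρ.fintsupport y, ρ i x) =ᶠ[𝓝 y] fun _ => 1 := by
    filter_upwards [ρ.eventually_finsupport_subset y] with x hx
    exact ρ.sum_finsupport' x (Set.mem_univ x) hx
  let dρ : N → E →L[ℝ] ℝ := fun i => mfderiv 𝓘(ℝ, E) 𝓘(ℝ, ℝ) (ρ i) y
  let df : N → E →L[ℝ] ℝ := fun i => mfderiv 𝓘(ℝ, E) 𝓘(ℝ, ℝ) (f i) y
  have hdρ : ∀ i, HasMFDerivAt 𝓘(ℝ, E) 𝓘(ℝ, ℝ) (ρ i) y (dρ i) :=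
    fun i => ((ρ i).contMDiff.mdifferentiable (by simp) y).hasMFDerivAt
  have hdf : ∀ i ∈ ρ.fintsupport y, HasMFDerivAt 𝓘(ℝ, E) 𝓘(ℝ, ℝ) (f i) y (df i) := fun i hi =>
    (((hf i).contMDiffAt ((hU i).mem_nhds (hI i hi))).mdifferentiableAt (by simp)).hasMFDerivAt
  have hzero : ∑ i ∈ ρ.fintsupport y, dρ i = 0 :=
    hasMFDerivAt_unique (I := 𝓘(ℝ, E)) (I' := 𝓘(ℝ, ℝ)) (HasMFDerivAt.finset_sum fun i _ => hdρ i)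
      ((hasMFDerivAt_const (1 : ℝ) y).congr_of_eventuallyEq hone)
  have hval : ∀ i ∈ ρ.fintsupport y, f i y = c y := fun i hi => (hfU i y ⟨hI i hi, hy⟩).1
  refine ⟨?_, ?_⟩
  · refine hsum.self_of_nhds.trans ?_
    have h1 := hone.self_of_nhds
    simp only at h1
    rw [← one_mul (c y), ← h1, Finset.sum_mul]
    exact Finset.sum_congr rfl fun i hi => by rw [Pi.mul_apply, hval i hi]
  · have h2 : HasMFDerivAt 𝓘(ℝ, E) 𝓘(ℝ, ℝ) (fun x => ∑ᶠ i, ρ i x • f i x) y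
        (∑ i ∈ ρ.fintsupport y, (ρ i y • df i + f i y • dρ i)) :=
      (HasMFDerivAt.finset_sum fun i hi => (hdρ i).mul (hdf i hi)).congr_of_eventuallyEq hsum
    have h3 : ∑ i ∈ ρ.fintsupport y, f i y • dρ i = 0 := by
      rw [Finset.sum_congr rfl fun i hi => by rw [hval i hi], ← Finset.smul_sum, hzero, smul_zero]
    have h4 : ∑ i ∈ ρ.fintsupport y, (ρ i y • df i + f i y • dρ i) =
        ∑ i ∈ ρ.fintsupport y, ρ i y • df i := by
      rw [Finset.sum_add_distrib, h3, add_zero]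
    refine (congrArg (· ∈ H y) (h2.mfderiv.trans h4)).mpr ?_
    exact Submodule.sum_mem _ fun i hi => Submodule.smul_mem _ _ (hfU i y ⟨hI i hi, hy⟩).2

end Glue

/-! ### Extension of functions on the leaf space to first class functions -/

/-- The function `a(z) + θ_{(z, 0)}((X z, 0), (0, w))` extends `a` off the slice `w = 0` in such a
way that its Hamiltonian vector field along the slice is `X`. -/
theorem TwoForm.fderiv_slice_extension {G : Type*} [NormedAddCommGroup G] [NormedSpace ℝ G]
    {C : Type*} [NormedAddCommGroup C] [NormedSpace ℝ C]
    {θ : G × C → (G × C) [⋀^Fin 2]→L[ℝ] ℝ} {X : G → G} {a : G → ℝ} {z : G}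
    (ha : DifferentiableAt ℝ a z) (hθ : DifferentiableAt ℝ θ (z, 0)) (hX : DifferentiableAt ℝ X z)
    (haX : ∀ u, fderiv ℝ a z u = θ (z, 0) ![(X z, 0), (u, 0)]) (v : G × C) :
    fderiv ℝ (fun q : G × C => a q.1 + θ (q.1, 0) ![(X q.1, 0), (0, q.2)]) (z, 0) v =
      θ (z, 0) ![(X z, 0), v] := by
  have hL : DifferentiableAt ℝ (fun z => bilin (θ (z, 0)) (X z, (0 : C))) z :=
    ((bilin.differentiableAt.comp z
      (hθ.comp z (differentiableAt_id.prodMk (differentiableAt_const 0)))).clm_apply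
        (hX.prodMk (differentiableAt_const 0)))
  have h0 : HasFDerivAt (fun q : G × C => bilin (θ (q.1, 0)) (X q.1, (0 : C))) _ (z, 0) :=
    HasFDerivAt.comp (g := fun z => bilin (θ (z, 0)) (X z, (0 : C))) ((z, 0) : G × C)
      hL.hasFDerivAt hasFDerivAt_fst
  have h1 := h0.clm_apply
    ((ContinuousLinearMap.inr ℝ G C).comp (ContinuousLinearMap.snd ℝ G C)).hasFDerivAt
  have h2 := (ha.hasFDerivAt.comp ((z, 0) : G × C) hasFDerivAt_fst).add h1
  have h3 : HasFDerivAt (fun q : G × C => a q.1 + θ (q.1, 0) ![(X q.1, 0), (0, q.2)]) _ (z, 0) :=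
    h2.congr_of_eventuallyEq (.of_forall fun q => by simp)
  rw [h3.fderiv]
  have h4 : v = (v.1, 0) + (0, v.2) := by simp
  conv_rhs => rw [h4, ← bilin_apply, map_add, bilin_apply, bilin_apply, ← haX]
  simp
  exact map_zero _

section Extension

variable {E : Type*} [NormedAddCommGroup E] [NormedSpace ℝ E] [FiniteDimensional ℝ E]
  {F : Type*} [NormedAddCommGroup F] [NormedSpace ℝ F] [FiniteDimensional ℝ F]
  {B : Type*} [NormedAddCommGroup B] [NormedSpace ℝ B] [FiniteDimensional ℝ B]
  {N : Type*} [TopologicalSpace N] [ChartedSpace E N] [IsManifold 𝓘(ℝ, E) ∞ N]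
  {Ω : SymplecticForm E N}
  {S : Type*} [TopologicalSpace S] [ChartedSpace F S] {ι : S → N}
  {Q : Type*} [TopologicalSpace Q] [ChartedSpace B Q] [IsManifold 𝓘(ℝ, B) ∞ Q]

/-- A function `g` on the reduced space has a local extension to `N` whose Hamiltonian vector field
is tangent to the submanifold. In coordinates `((b, c), w)` with the submanifold at `w = 0` and `p`
the projection to `b`, the tangent field is the horizontal lift `((X_g, 0), 0)`, and the extension is
chosen affine in `w` with the slope that this field prescribes. -/
theorem exists_local_extension {p : S → Q} (hι : Manifold.IsSmoothEmbedding 𝓘(ℝ, F) 𝓘(ℝ, E) ∞ ι)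
    (hp : Manifold.IsSubmersion 𝓘(ℝ, F) 𝓘(ℝ, B) ∞ p) (Ω' : SymplecticForm B Q)
    (hΩ' : TwoForm.pullback (F := F) p Ω'.form = TwoForm.pullback (F := F) ι Ω.form)
    (g : C^∞⟮𝓘(ℝ, B), Q; ℝ⟯) (s : S) :
    ∃ (U : Set N) (f : N → ℝ), IsOpen U ∧ ι s ∈ U ∧ ContMDiffOn 𝓘(ℝ, E) 𝓘(ℝ, ℝ) ∞ f U ∧
      ∀ t, ι t ∈ U → f (ι t) = g (p t) ∧
        ∃ w : TangentSpace 𝓘(ℝ, F) t, ∀ v : TangentSpace 𝓘(ℝ, E) (ι t),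
          (Ω.form (ι t) ![mfderiv 𝓘(ℝ, F) 𝓘(ℝ, E) ι t w, v] : ℝ) =
            mfderiv 𝓘(ℝ, E) 𝓘(ℝ, ℝ) f (ι t) v := by
  obtain ⟨C, _, _, _, Φ, κ, h, hs⟩ := (hp.isSubmersionAt s).exists_chart
  obtain ⟨C', _, _, _, Θ, hΘ, hsΘ, hιΘ⟩ := hι.exists_chart h.smooth_dom hs
  let θ : (B × C) × C' → ((B × C) × C') [⋀^Fin 2]→L[ℝ] ℝ :=
    TwoForm.pullback (F := (B × C) × C') Θ.symm Ω.form
  let θ' : B → B [⋀^Fin 2]→L[ℝ] ℝ := TwoForm.pullback (F := B) κ.symm Ω'.form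
  let X : B × C → B × C := fun z => (TwoForm.hamVec (G := B) θ' (g ∘ κ.symm) z.1, 0)
  let a : B × C → ℝ := fun z => g (κ.symm z.1)
  let k : (B × C) × C' → ℝ := fun q => a q.1 + θ (q.1, 0) ![(X q.1, 0), (0, q.2)]
  let V : Set ((B × C) × C') := {q | (q.1, 0) ∈ Θ.target ∧ q.1 ∈ Φ.target}
  have hV : IsOpen V :=
    (Θ.open_target.preimage (continuous_fst.prodMk continuous_const)).inter
      (Φ.open_target.preimage continuous_fst)
  have hθs : ∀ q ∈ Θ.target, ContDiffAt ℝ ∞ θ q := fun q hq =>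
    TwoForm.contDiffAt_pullback Ω.smooth (hΘ.contMDiffAt_symm hq)
  have hXs : ∀ z ∈ Φ.target, ContDiffAt ℝ ∞ X z := fun z hz =>
    ((Ω'.contDiffAt_hamVec_chart g h.smooth_cod (h.fst_mem_target hz)).comp z
      contDiffAt_fst).prodMk contDiffAt_const
  have has : ∀ z ∈ Φ.target, ContDiffAt ℝ ∞ a z := fun z hz =>
    (SymplecticForm.contDiffAt_comp_symm g h.smooth_cod (h.fst_mem_target hz)).comp z
      contDiffAt_fst
  have hks : ∀ q ∈ V, ContDiffAt ℝ ∞ k q := fun q hq => by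
    refine ((has _ hq.2).comp q contDiffAt_fst).add ?_
    refine ContDiffAt.twoForm_apply (G := (B × C) × C') (θ := fun q : (B × C) × C' => θ (q.1, 0))
      ?_ ?_ ?_
    · exact (hθs _ hq.1).comp q (contDiffAt_fst.prodMk contDiffAt_const)
    · exact ((hXs _ hq.2).comp q contDiffAt_fst).prodMk contDiffAt_const
    · exact contDiffAt_const.prodMk contDiffAt_snd
  -- Along the submanifold, `Ω` and `Ω'` have the same local representative.
  have hform : ∀ t, ι t ∈ Θ.source → ∀ b u : B × C, θ (Φ t, 0) ![(b, 0), (u, 0)] =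
      θ' (Φ t).1 ![b.1, u.1] := fun t ht b u => by
    have htΦ := (hιΘ t ht).1
    have hz := Φ.map_source htΦ
    have hq : (Φ t, (0 : C')) ∈ Θ.target := by
      rw [← (hιΘ t ht).2]
      exact Θ.map_source ht
    have hΦs := (h.smooth_dom.contMDiffAt_symm hz).mdifferentiableAt (by simp)
    have e1 : Θ.symm ∘ ContinuousLinearMap.inl ℝ (B × C) C' =ᶠ[𝓝 (Φ t)] ι ∘ Φ.symm := by
      have hc : Filter.Tendsto (ι ∘ Φ.symm) (𝓝 (Φ t)) (𝓝 (ι t)) := by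
        have h1 := (hι.contMDiff.continuous.continuousAt (x := Φ.symm (Φ t))).comp
          (Φ.continuousAt_symm hz)
        simpa [ContinuousAt, Φ.left_inv htΦ] using h1
      filter_upwards [Φ.open_target.mem_nhds hz, hc.eventually (Θ.open_source.mem_nhds ht)]
        with z' hz' hz''
      have h2 := (hιΘ _ hz'').2
      rw [Φ.right_inv hz'] at h2
      exact (congrArg Θ.symm h2).symm.trans (Θ.left_inv hz'')
    have e2 : p ∘ Φ.symm =ᶠ[𝓝 (Φ t)] κ.symm ∘ ContinuousLinearMap.fst ℝ B C := by
      filter_upwards [Φ.open_target.mem_nhds hz] with z' hz' using h.apply_symm hz'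
    have h1 := TwoForm.pullback_pullback (F := (B × C) × C') (x := Φ t)
      (g := ContinuousLinearMap.inl ℝ (B × C) C') Ω.form
      ((hΘ.contMDiffAt_symm hq).mdifferentiableAt (by simp))
      (ContinuousLinearMap.inl ℝ (B × C) C').mdifferentiableAt
    have h2 := TwoForm.pullback_pullback (F := B) (x := Φ t)
      (g := ContinuousLinearMap.fst ℝ B C) Ω'.form
      ((h.smooth_cod.contMDiffAt_symm (h.fst_mem_target hz)).mdifferentiableAt (by simp))
      (ContinuousLinearMap.fst ℝ B C).mdifferentiableAt
    rw [TwoForm.pullback_congr _ e1, ← TwoForm.pullback_pullback (F := F) _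
      (hι.contMDiff.mdifferentiable (by simp) _) hΦs, ← hΩ', TwoForm.pullback_pullback (F := F) _
      (hp.contMDiff.mdifferentiable (by simp) _) hΦs, TwoForm.pullback_congr _ e2, ← h2] at h1
    have h3 := DFunLike.congr_fun h1 ![b, u]
    have h4 := TwoForm.pullback_apply (ContinuousLinearMap.inl ℝ (B × C) C')
      (TwoForm.pullback (F := (B × C) × C') Θ.symm Ω.form) (Φ t) b u
    have h5 := TwoForm.pullback_apply (ContinuousLinearMap.fst ℝ B C)
      (TwoForm.pullback (F := B) κ.symm Ω'.form) (Φ t) b u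
    rw [mfderiv_eq_fderiv, ContinuousLinearMap.fderiv] at h4 h5
    exact h4.symm.trans (h3.trans h5)
  refine ⟨Θ.source ∩ Θ ⁻¹' V, k ∘ Θ, Θ.isOpen_inter_preimage hV, ⟨hsΘ, ?_⟩, fun x hx => ?_,
    fun t ht => ?_⟩
  · have h1 := (hιΘ s hsΘ).2
    refine ⟨?_, ?_⟩
    · rw [h1]
      change (Φ s, 0) ∈ Θ.target
      rw [← h1]
      exact Θ.map_source hsΘ
    · rw [h1]
      exact Φ.map_source hs
  · exact ((hks _ hx.2).contMDiffAt.comp x (hΘ.contMDiffAt hx.1)).contMDiffWithinAt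
  · obtain ⟨htΦ, hq⟩ := hιΘ t ht.1
    have hz := Φ.map_source htΦ
    have hqt : (Φ t, (0 : C')) ∈ Θ.target := by
      rw [← hq]
      exact Θ.map_source ht.1
    have hΘd := (hΘ.contMDiffAt ht.1).mdifferentiableAt (by simp)
    have hkd : DifferentiableAt ℝ k (Θ (ι t)) := (hks _ ht.2).differentiableAt (by simp)
    refine ⟨?_, ?_⟩
    · have h0 : θ (Φ t, 0) ![(X (Φ t), 0), (0, 0)] = 0 :=
        (θ (Φ t, 0)).toAlternatingMap.map_coord_zero (m := ![(X (Φ t), 0), (0, 0)]) 1 rfl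
      have h1 : κ.symm (Φ t).1 = p t := by
        rw [← h.apply_eq t htΦ]
        exact κ.left_inv (h.mem_source t htΦ)
      change k (Θ (ι t)) = _
      rw [hq]
      change g (κ.symm (Φ t).1) + θ (Φ t, 0) ![(X (Φ t), 0), (0, 0)] = _
      rw [h0, add_zero, h1]
    · obtain ⟨w, hw⟩ := (h.smooth_dom.mdifferentiable.mfderiv_bijective htΦ).2 (X (Φ t))
      refine ⟨w, fun v => ?_⟩
      have hdΘι : (mfderiv 𝓘(ℝ, E) 𝓘(ℝ, (B × C) × C') Θ (ι t)
          (mfderiv 𝓘(ℝ, F) 𝓘(ℝ, E) ι t w) : (B × C) × C') = (X (Φ t), 0) := by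
        have e1 : Θ ∘ ι =ᶠ[𝓝 t] ContinuousLinearMap.inl ℝ (B × C) C' ∘ Φ := by
          filter_upwards [hι.contMDiff.continuous.continuousAt.preimage_mem_nhds
            (Θ.open_source.mem_nhds ht.1)] with t' ht' using (hιΘ t' ht').2
        have h1 := e1.mfderiv_eq (I := 𝓘(ℝ, F)) (I' := 𝓘(ℝ, (B × C) × C'))
        rw [mfderiv_comp t hΘd (hι.contMDiff.mdifferentiable (by simp) _),
          mfderiv_comp t (ContinuousLinearMap.inl ℝ (B × C) C').mdifferentiableAt
            ((h.smooth_dom.contMDiffAt htΦ).mdifferentiableAt (by simp)),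
          ContinuousLinearMap.mfderiv_eq] at h1
        refine (DFunLike.congr_fun h1 w).trans ?_
        exact congrArg (ContinuousLinearMap.inl ℝ (B × C) C') hw
      have hpb : ∀ A : TangentSpace 𝓘(ℝ, E) (ι t), (Ω.form (ι t) ![A, v] : ℝ) = θ (Θ (ι t))
          ![mfderiv 𝓘(ℝ, E) 𝓘(ℝ, (B × C) × C') Θ (ι t) A,
            mfderiv 𝓘(ℝ, E) 𝓘(ℝ, (B × C) × C') Θ (ι t) v] := fun A => by
        have e1 : Θ.symm ∘ Θ =ᶠ[𝓝 (ι t)] id := by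
          filter_upwards [Θ.open_source.mem_nhds ht.1] with x hx using Θ.left_inv hx
        have h1 := TwoForm.pullback_pullback (F := (B × C) × C') (x := ι t) Ω.form
          ((hΘ.contMDiffAt_symm (Θ.map_source ht.1)).mdifferentiableAt (by simp)) hΘd
        rw [TwoForm.pullback_congr _ e1] at h1
        have h2 := TwoForm.pullback_apply id Ω.form (ι t) A v
        rw [mfderiv_id] at h2
        exact h2.symm.trans ((DFunLike.congr_fun h1 ![A, v]).symm.trans
          (TwoForm.pullback_apply Θ _ (ι t) A v))
      rw [hpb, mfderiv_comp (ι t) hkd.mdifferentiableAt hΘd, mfderiv_eq_fderiv]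
      have hslice := TwoForm.fderiv_slice_extension (θ := θ) (X := X) (a := a) (z := Φ t)
        ((has _ hz).differentiableAt (by simp)) ((hθs _ hqt).differentiableAt (by simp))
        ((hXs _ hz).differentiableAt (by simp)) (fun u => ?_)
        (mfderiv 𝓘(ℝ, E) 𝓘(ℝ, (B × C) × C') Θ (ι t) v)
      · refine Eq.trans ?_ (hslice.symm.trans ?_)
        · exact congrArg₂ (fun q b => θ q ![b, mfderiv 𝓘(ℝ, E) 𝓘(ℝ, (B × C) × C') Θ (ι t) v])
            hq hdΘι
        · exact congrArg (fun q => fderiv ℝ k q (mfderiv 𝓘(ℝ, E) 𝓘(ℝ, (B × C) × C') Θ (ι t) v))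
            hq.symm
      · rw [hform t ht.1]
        have h1 : HasFDerivAt a ((fderiv ℝ (g ∘ κ.symm) (Φ t).1).comp
            (ContinuousLinearMap.fst ℝ B C)) (Φ t) :=
          ((SymplecticForm.contDiffAt_comp_symm g h.smooth_cod
            (h.fst_mem_target hz)).differentiableAt (by simp)).hasFDerivAt.comp (Φ t) hasFDerivAt_fst
        rw [h1.fderiv]
        exact (TwoForm.apply_hamVec (G := B) (TwoForm.injective_bilin_pullback
          (Ω'.nondegenerate _) (h.smooth_cod.bijective_mfderiv_symm (h.fst_mem_target hz)))
          u.1).symm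

end Extension

/-! ### Reduction of first class functions -/

section Descent

variable {F : Type*} [NormedAddCommGroup F] [NormedSpace ℝ F] [FiniteDimensional ℝ F]
  {S : Type*} [TopologicalSpace S] [ChartedSpace F S]
  {B : Type*} [NormedAddCommGroup B] [NormedSpace ℝ B]
  {Q : Type*} [TopologicalSpace Q] [ChartedSpace B Q] {p : S → Q}
  {V : Type*} [NormedAddCommGroup V] [NormedSpace ℝ V]

/-- Smoothness of a map can be tested after composition with a surjective submersion, because the
latter has smooth local sections. -/
theorem Manifold.IsSubmersion.contMDiff_of_comp (hp : Manifold.IsSubmersion 𝓘(ℝ, F) 𝓘(ℝ, B) ∞ p)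
    (hsurj : Function.Surjective p) {g : Q → V} (hg : ContMDiff 𝓘(ℝ, F) 𝓘(ℝ, V) ∞ (g ∘ p)) :
    ContMDiff 𝓘(ℝ, B) 𝓘(ℝ, V) ∞ g := fun b => by
  obtain ⟨s, rfl⟩ := hsurj b
  obtain ⟨C, _, _, _, Φ, κ, h, hs⟩ := (hp.isSubmersionAt s).exists_chart
  let m : Q → B × C := fun b => (κ b, (Φ s).2)
  have hκs := h.mem_source s hs
  have hm : ContMDiffAt 𝓘(ℝ, B) 𝓘(ℝ, B × C) ∞ m (p s) :=
    (contDiff_id.prodMk contDiff_const : ContDiff ℝ ∞ fun b : B => (b, (Φ s).2)).contMDiff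
      |>.contMDiffAt.comp (p s) (h.smooth_cod.contMDiffAt hκs)
  have hms : m (p s) = Φ s := Prod.ext (h.apply_eq s hs) rfl
  have hmt : m (p s) ∈ Φ.target := by
    rw [hms]
    exact Φ.map_source hs
  refine ((hg.contMDiffAt.comp (p s) ((h.smooth_dom.contMDiffAt_symm hmt).comp (p s)
    hm))).congr_of_eventuallyEq ?_
  filter_upwards [κ.open_source.mem_nhds hκs,
    hm.continuousAt.preimage_mem_nhds (Φ.open_target.mem_nhds hmt)] with b hb hb'
  exact congrArg g ((h.apply_symm hb').trans (κ.left_inv hb)).symm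

end Descent

section Reduction

variable {E : Type*} [NormedAddCommGroup E] [NormedSpace ℝ E] [FiniteDimensional ℝ E]
  {F : Type*} [NormedAddCommGroup F] [NormedSpace ℝ F]
  {B : Type*} [NormedAddCommGroup B] [NormedSpace ℝ B]
  {N : Type*} [TopologicalSpace N] [ChartedSpace E N]
  {Ω : SymplecticForm E N}
  {S : Type*} [TopologicalSpace S] [ChartedSpace F S] {ι : S → N}

/-- Every function on the reduced space is the reduction of a first class function. -/
theorem exists_firstClass_extension [FiniteDimensional ℝ F] [FiniteDimensional ℝ B]
    [IsManifold 𝓘(ℝ, E) ∞ N] [T2Space N] [SecondCountableTopology N]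
    {Q : Type*} [TopologicalSpace Q] [ChartedSpace B Q] [IsManifold 𝓘(ℝ, B) ∞ Q] {p : S → Q}
    (hι : Manifold.IsSmoothEmbedding 𝓘(ℝ, F) 𝓘(ℝ, E) ∞ ι) (hclosed : IsClosed (Set.range ι))
    (hp : Manifold.IsSubmersion 𝓘(ℝ, F) 𝓘(ℝ, B) ∞ p) (Ω' : SymplecticForm B Q)
    (hΩ' : TwoForm.pullback (F := F) p Ω'.form = TwoForm.pullback (F := F) ι Ω.form)
    (g : C^∞⟮𝓘(ℝ, B), Q; ℝ⟯) :
    ∃ f ∈ firstClassFunctions (F := F) Ω ι, ∀ s, f (ι s) = g (p s) := by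
  have hinj := hι.isEmbedding.injective
  -- The tangent space of the submanifold at `y`, and `0` at the points off the submanifold.
  let T : ∀ y : N, Submodule ℝ (TangentSpace 𝓘(ℝ, E) y) := fun y =>
    ⨆ (t : S) (h : ι t = y),
      h ▸ LinearMap.range (mfderiv 𝓘(ℝ, F) 𝓘(ℝ, E) ι t).toLinearMap
  have hT : ∀ t, T (ι t) = LinearMap.range (mfderiv 𝓘(ℝ, F) 𝓘(ℝ, E) ι t).toLinearMap := fun t => by
    refine le_antisymm (iSup₂_le fun t' h => ?_) (le_iSup₂_of_le t rfl le_rfl)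
    obtain rfl := hinj h
    rfl
  let toDual : ∀ y : N, (E →L[ℝ] ℝ) →ₗ[ℝ] Module.Dual ℝ (TangentSpace 𝓘(ℝ, E) y) := fun y =>
    ContinuousLinearMap.coeLM ℝ (M := E) (N₃ := ℝ)
  obtain ⟨f, hf⟩ := exists_contMDiffMap_glue hclosed (Function.extend ι (g ∘ p) 0)
    (fun y => (T y).comap ((Ω.sharp y).toLinearMap.comp (toDual y))) (by
      rintro _ ⟨s, rfl⟩
      obtain ⟨U, f, hU, hsU, hf, hfU⟩ := exists_local_extension hι hp Ω' hΩ' g s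
      refine ⟨U, f, hU, hsU, hf, ?_⟩
      rintro _ ⟨htU, t, rfl⟩
      obtain ⟨h1, w, hw⟩ := hfU t htU
      refine ⟨h1.trans (hinj.extend_apply (g ∘ p) 0 t).symm, ?_⟩
      change Ω.sharp (ι t) (mfderiv 𝓘(ℝ, E) 𝓘(ℝ, ℝ) f (ι t)).toLinearMap ∈ T (ι t)
      rw [hT, ← Ω.eq_sharp hw]
      exact ⟨w, rfl⟩)
  refine ⟨f, fun s => ?_, fun s => ?_⟩
  · have h1 := (hf (ι s) ⟨s, rfl⟩).2
    rw [← hT]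
    exact h1
  · rw [(hf (ι s) ⟨s, rfl⟩).1, hinj.extend_apply]
    rfl

section

variable {Q : Type*} [TopologicalSpace Q] [ChartedSpace B Q] {p : S → Q}
  {Ω' : SymplecticForm B Q}

omit [FiniteDimensional ℝ E] in
theorem differential_comp_apply (f : C^∞⟮𝓘(ℝ, E), N; ℝ⟯) (hι : ContMDiff 𝓘(ℝ, F) 𝓘(ℝ, E) ∞ ι)
    (s : S) (v : TangentSpace 𝓘(ℝ, F) s) :
    (mfderiv 𝓘(ℝ, F) 𝓘(ℝ, ℝ) (f ∘ ι) s v : ℝ) =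
      differential f (ι s) (mfderiv 𝓘(ℝ, F) 𝓘(ℝ, E) ι s v) := by
  rw [mfderiv_comp s (f.contMDiff.mdifferentiable (by simp) _) (hι.mdifferentiable (by simp) _)]
  rfl

/-- The restriction of a first class function is invariant: its differential vanishes on the kernel
of the restricted form. -/
theorem differential_firstClass_eq_zero
    (hΩ' : TwoForm.pullback (F := F) p Ω'.form = TwoForm.pullback (F := F) ι Ω.form)
    {f : C^∞⟮𝓘(ℝ, E), N; ℝ⟯} (hf : f ∈ firstClassFunctions (F := F) Ω ι) {s : S}
    {v : TangentSpace 𝓘(ℝ, F) s} (hv : (mfderiv 𝓘(ℝ, F) 𝓘(ℝ, B) p s v : B) = 0) :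
    (differential f (ι s) (mfderiv 𝓘(ℝ, F) 𝓘(ℝ, E) ι s v) : ℝ) = 0 := by
  obtain ⟨w, hw⟩ := hf s
  rw [← Ω.form_hamiltonian, ← hw]
  refine (TwoForm.pullback_apply ι Ω.form s w v).symm.trans ?_
  refine (DFunLike.congr_fun (congrFun hΩ' s) ![w, v]).symm.trans
    ((TwoForm.pullback_apply p Ω'.form s w v).trans ?_)
  exact (Ω'.form (p s)).toAlternatingMap.map_coord_zero
    (m := ![mfderiv 𝓘(ℝ, F) 𝓘(ℝ, B) p s w, mfderiv 𝓘(ℝ, F) 𝓘(ℝ, B) p s v]) 1 hv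

variable [FiniteDimensional ℝ B]

/-- Reduction maps Hamiltonian vector fields to Hamiltonian vector fields. -/
theorem mfderiv_eq_hamiltonian (hι : ContMDiff 𝓘(ℝ, F) 𝓘(ℝ, E) ∞ ι)
    (hp : ContMDiff 𝓘(ℝ, F) 𝓘(ℝ, B) ∞ p)
    (hΩ' : TwoForm.pullback (F := F) p Ω'.form = TwoForm.pullback (F := F) ι Ω.form)
    {f : C^∞⟮𝓘(ℝ, E), N; ℝ⟯} {f' : C^∞⟮𝓘(ℝ, B), Q; ℝ⟯} (hff' : ∀ s, f' (p s) = f (ι s)) {s : S}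
    (hps : Function.Surjective (mfderiv 𝓘(ℝ, F) 𝓘(ℝ, B) p s))
    {w : TangentSpace 𝓘(ℝ, F) s} (hw : mfderiv 𝓘(ℝ, F) 𝓘(ℝ, E) ι s w = Ω.hamiltonian f (ι s)) :
    mfderiv 𝓘(ℝ, F) 𝓘(ℝ, B) p s w = Ω'.hamiltonian f' (p s) := by
  refine Ω'.eq_sharp fun v => ?_
  obtain ⟨v, rfl⟩ := hps v
  refine (TwoForm.pullback_apply p Ω'.form s w v).symm.trans
    ((DFunLike.congr_fun (congrFun hΩ' s) ![w, v]).trans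
      ((TwoForm.pullback_apply ι Ω.form s w v).trans ?_))
  rw [hw, Ω.form_hamiltonian]
  have e : f' ∘ p = f ∘ ι := funext hff'
  refine (differential_comp_apply f hι s v).symm.trans
    (Eq.trans ?_ (differential_comp_apply f' hp s v))
  rw [e]

/-- Reduction preserves brackets. -/
theorem bracket_reduction (hι : ContMDiff 𝓘(ℝ, F) 𝓘(ℝ, E) ∞ ι)
    (hp : ContMDiff 𝓘(ℝ, F) 𝓘(ℝ, B) ∞ p)
    (hΩ' : TwoForm.pullback (F := F) p Ω'.form = TwoForm.pullback (F := F) ι Ω.form)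
    {f g : C^∞⟮𝓘(ℝ, E), N; ℝ⟯} (hf : f ∈ firstClassFunctions (F := F) Ω ι)
    (hg : g ∈ firstClassFunctions (F := F) Ω ι) {f' g' : C^∞⟮𝓘(ℝ, B), Q; ℝ⟯}
    (hff' : ∀ s, f' (p s) = f (ι s)) (hgg' : ∀ s, g' (p s) = g (ι s)) {s : S}
    (hps : Function.Surjective (mfderiv 𝓘(ℝ, F) 𝓘(ℝ, B) p s)) :
    Ω'.bracket f' g' (p s) = Ω.bracket f g (ι s) := by
  obtain ⟨w, hw⟩ := hf s
  obtain ⟨w', hw'⟩ := hg s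
  have h1 := mfderiv_eq_hamiltonian hι hp hΩ' hff' hps hw
  have h2 := mfderiv_eq_hamiltonian hι hp hΩ' hgg' hps hw'
  rw [SymplecticForm.bracket, SymplecticForm.bracket, ← h1, ← h2, ← hw, ← hw']
  exact (TwoForm.pullback_apply p Ω'.form s w w').symm.trans
    ((DFunLike.congr_fun (congrFun hΩ' s) ![w, w']).trans
      (TwoForm.pullback_apply ι Ω.form s w w'))

end

end Reduction

section Pushforward

universe u

variable {E : Type*} [NormedAddCommGroup E] [NormedSpace ℝ E] [FiniteDimensional ℝ E]
  {F : Type*} [NormedAddCommGroup F] [NormedSpace ℝ F] [FiniteDimensional ℝ F]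
  {B : Type*} [NormedAddCommGroup B] [NormedSpace ℝ B]
  {N : Type*} [TopologicalSpace N] [ChartedSpace E N]
  {Ω : SymplecticForm E N}
  {S : Type u} [TopologicalSpace S] [ChartedSpace F S] {ι : S → N} {r : ℕ} {K : Setoid S}
  {D : ∀ s : S, Submodule ℝ (TangentSpace 𝓘(ℝ, F) s)} (hK : IsFoliationBy D r K)
  [ChartedSpace B (Quotient K)] [IsManifold 𝓘(ℝ, B) ∞ (Quotient K)]
  (hp : Manifold.IsSubmersion 𝓘(ℝ, F) 𝓘(ℝ, B) ∞ (Quotient.mk K))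

include hK hp

/-- A smooth function whose differential vanishes along the leaves is constant on each leaf. -/
theorem IsFoliationBy.eq_of_mfderiv_eq_zero {f : S → ℝ} (hf : ContMDiff 𝓘(ℝ, F) 𝓘(ℝ, ℝ) ∞ f)
    (hf' : ∀ (s : S) (v : TangentSpace 𝓘(ℝ, F) s),
      (mfderiv 𝓘(ℝ, F) 𝓘(ℝ, B) (Quotient.mk K) s v : B) = 0 →
        (mfderiv 𝓘(ℝ, F) 𝓘(ℝ, ℝ) f s v : ℝ) = 0) {s t : S} (hst : K s t) : f s = f t := by
  refine hK.eq_of_rel (fun s => ?_) hst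
  obtain ⟨C, _, _, _, Φ, κ, h, hs⟩ := (hp.isSubmersionAt s).exists_chart
  have hd : ∀ z ∈ Φ.target, MDifferentiableAt 𝓘(ℝ, B × C) 𝓘(ℝ, F) Φ.symm z := fun z hz =>
    (h.smooth_dom.contMDiffAt_symm hz).mdifferentiableAt (by simp)
  have h1 := h.eventually_eq_of_fderiv_vertical (W := f ∘ Φ.symm)
    (fun z hz => mdifferentiableAt_iff_differentiableAt.mp
      ((hf.mdifferentiable (by simp) _).comp z (hd z hz)))
    (fun z hz c => by
      rw [← mfderiv_eq_fderiv, mfderiv_comp z (hf.mdifferentiable (by simp) _) (hd z hz)]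
      exact hf' _ _ ((h.mfderiv_eq_zero_iff hp.contMDiff hz _).mpr rfl)) hs
  filter_upwards [h1, Φ.open_source.mem_nhds hs] with t ht hts he
  simpa [Φ.left_inv hs, Φ.left_inv hts] using ht he

variable (hι : ContMDiff 𝓘(ℝ, F) 𝓘(ℝ, E) ∞ ι) {Ω' : SymplecticForm B (Quotient K)}
  (hΩ' : TwoForm.pullback (F := F) (Quotient.mk K) Ω'.form = TwoForm.pullback (F := F) ι Ω.form)

include hι hΩ'

theorem firstClass_eq_of_rel (f : firstClassFunctions (F := F) Ω ι) {s t : S} (hst : K s t) :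
    (f : C^∞⟮𝓘(ℝ, E), N; ℝ⟯) (ι s) = (f : C^∞⟮𝓘(ℝ, E), N; ℝ⟯) (ι t) :=
  hK.eq_of_mfderiv_eq_zero (f := (f : C^∞⟮𝓘(ℝ, E), N; ℝ⟯) ∘ ι) hp
    (f.1.contMDiff.comp hι) (fun s v hv => (differential_comp_apply f.1 hι s v).trans
      (differential_firstClass_eq_zero hΩ' f.2 hv)) hst

/-- The reduction map from first class functions to functions on the leaf space. -/
noncomputable def firstClassPushforward :
    firstClassFunctions (F := F) Ω ι →ₐ[ℝ] C^∞⟮𝓘(ℝ, B), Quotient K; ℝ⟯ where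
  toFun f := ⟨Quotient.lift (fun s => (f : C^∞⟮𝓘(ℝ, E), N; ℝ⟯) (ι s))
    fun _ _ h => firstClass_eq_of_rel hK hp hι hΩ' f h,
    hp.contMDiff_of_comp Quotient.mk_surjective (f.1.contMDiff.comp hι)⟩
  map_one' := by
    ext b
    induction b using Quotient.ind
    rfl
  map_mul' f g := by
    ext b
    induction b using Quotient.ind
    rfl
  map_zero' := by
    ext b
    induction b using Quotient.ind
    rfl
  map_add' f g := by
    ext b
    induction b using Quotient.ind
    rfl
  commutes' c := by
    ext b
    induction b using Quotient.ind
    rfl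

theorem firstClassPushforward_mk (f : firstClassFunctions (F := F) Ω ι) (s : S) :
    firstClassPushforward hK hp hι hΩ' f (Quotient.mk K s) = (f : C^∞⟮𝓘(ℝ, E), N; ℝ⟯) (ι s) :=
  rfl

theorem ker_firstClassPushforward : RingHom.ker (firstClassPushforward hK hp hι hΩ') =
    firstClassConstraints (F := F) Ω ι := by
  ext f
  rw [RingHom.mem_ker]
  constructor
  · intro h s
    rw [← firstClassPushforward_mk hK hp hι hΩ', h]
    rfl
  · intro h
    ext b
    obtain ⟨s, rfl⟩ := Quotient.exists_rep b
    exact h s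

end Pushforward

/-! ### First class functions are closed under the bracket -/

section Closure

variable {E : Type*} [NormedAddCommGroup E] [NormedSpace ℝ E] [FiniteDimensional ℝ E]
  {F : Type*} [NormedAddCommGroup F] [NormedSpace ℝ F]
  {N : Type*} [TopologicalSpace N] [ChartedSpace E N] [IsManifold 𝓘(ℝ, E) ∞ N]
  {Ω : SymplecticForm E N}
  {S : Type*} [TopologicalSpace S] [ChartedSpace F S] {ι : S → N}

/-- A smooth function on an open set `U` agrees near a given point of `U` with a global smooth
function that is a multiple of it on `U` and vanishes off `U`. -/
theorem exists_contMDiffMap_eventuallyEq [T2Space N] {U : Set N} (hU : IsOpen U) {k : N → ℝ}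
    (hk : ContMDiffOn 𝓘(ℝ, E) 𝓘(ℝ, ℝ) ∞ k U) {x : N} (hx : x ∈ U) :
    ∃ c : C^∞⟮𝓘(ℝ, E), N; ℝ⟯, c =ᶠ[𝓝 x] k ∧ ∀ y, (y ∈ U → k y = 0) → c y = 0 := by
  obtain ⟨ρ, hρ⟩ := ((SmoothBumpFunction.nhds_basis_tsupport (I := 𝓘(ℝ, E)) x).mem_iff).mp
    (hU.mem_nhds hx)
  have hsm : ContMDiff 𝓘(ℝ, E) 𝓘(ℝ, ℝ) ∞ fun y => ρ y * k y := by
    refine contMDiff_of_tsupport fun y hy => ?_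
    have hyU : y ∈ U := hρ.2 (tsupport_mul_subset_left hy)
    exact (ρ.contMDiff.contMDiffAt).mul (hk.contMDiffAt (hU.mem_nhds hyU))
  refine ⟨⟨_, hsm⟩, ?_, fun y hy => ?_⟩
  · filter_upwards [ρ.eventuallyEq_one] with y hy
    change ρ y * k y = k y
    rw [hy, Pi.one_apply, one_mul]
  · change ρ y * k y = 0
    by_cases hyU : y ∈ U
    · rw [hy hyU, mul_zero]
    · rw [image_eq_zero_of_notMem_tsupport fun h => hyU (hρ.2 h), zero_mul]

/-- The tangent spaces of an embedded submanifold are cut out by the differentials of the functions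
that vanish on it. -/
theorem mem_range_mfderiv_of_differential_eq_zero [T2Space N] [IsManifold 𝓘(ℝ, F) ∞ S]
    (hι : Manifold.IsSmoothEmbedding 𝓘(ℝ, F) 𝓘(ℝ, E) ∞ ι) {s : S}
    {X : TangentSpace 𝓘(ℝ, E) (ι s)}
    (hX : ∀ c : C^∞⟮𝓘(ℝ, E), N; ℝ⟯, (∀ t, c (ι t) = 0) → differential c (ι s) X = 0) :
    X ∈ LinearMap.range (mfderiv 𝓘(ℝ, F) 𝓘(ℝ, E) ι s).toLinearMap := by
  have hΦ := OpenPartialHomeomorph.IsSmoothChart.chartAt (E := F) s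
  have hs := mem_chart_source F s
  obtain ⟨C, _, _, _, Θ, hΘ, hsΘ, hιΘ⟩ := hι.exists_chart hΦ hs
  have hΘd := (hΘ.contMDiffAt hsΘ).mdifferentiableAt (by simp)
  let dX : F × C := mfderiv 𝓘(ℝ, E) 𝓘(ℝ, F × C) Θ (ι s) X
  have hsnd : dX.2 = 0 := by
    refine SeparatingDual.eq_zero_of_forall_dual_eq_zero (R := ℝ) fun l => ?_
    let L : F × C →L[ℝ] ℝ := l.comp (ContinuousLinearMap.snd ℝ F C)
    obtain ⟨c, hc, hc0⟩ := exists_contMDiffMap_eventuallyEq Θ.open_source (k := L ∘ Θ)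
      (fun x hx => (L.contMDiff.contMDiffAt.comp x (hΘ.contMDiffAt hx)).contMDiffWithinAt) hsΘ
    have h1 := hX c fun t => hc0 _ fun ht => by
      change l (Θ (ι t)).2 = 0
      rw [(hιΘ t ht).2, map_zero]
    have h2 := hc.mfderiv_eq (I := 𝓘(ℝ, E)) (I' := 𝓘(ℝ, ℝ))
    rw [mfderiv_comp _ L.mdifferentiableAt hΘd, ContinuousLinearMap.mfderiv_eq] at h2
    exact (DFunLike.congr_fun h2 X).symm.trans h1
  obtain ⟨w, hw⟩ := (hΦ.mdifferentiable.mfderiv_bijective hs).2 dX.1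
  refine ⟨w, (hΘ.mdifferentiable.mfderiv_bijective hsΘ).1 ?_⟩
  have e1 : Θ ∘ ι =ᶠ[𝓝 s] ContinuousLinearMap.inl ℝ F C ∘ chartAt F s := by
    filter_upwards [hι.contMDiff.continuous.continuousAt.preimage_mem_nhds
      (Θ.open_source.mem_nhds hsΘ)] with t ht using (hιΘ t ht).2
  have h1 := e1.mfderiv_eq (I := 𝓘(ℝ, F)) (I' := 𝓘(ℝ, F × C))
  rw [mfderiv_comp s hΘd (hι.contMDiff.mdifferentiable (by simp) _),
    mfderiv_comp s (ContinuousLinearMap.inl ℝ F C).mdifferentiableAt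
      ((hΦ.contMDiffAt hs).mdifferentiableAt (by simp)), ContinuousLinearMap.mfderiv_eq] at h1
  refine (DFunLike.congr_fun h1 w).trans ?_
  exact (congrArg (ContinuousLinearMap.inl ℝ F C) hw).trans (Prod.ext rfl hsnd.symm)

omit [IsManifold 𝓘(ℝ, E) ∞ N] in
/-- Brackets with first class functions preserve the functions that vanish on the submanifold. -/
theorem bracket_firstClass_eq_zero (hι : ContMDiff 𝓘(ℝ, F) 𝓘(ℝ, E) ∞ ι)
    {f c : C^∞⟮𝓘(ℝ, E), N; ℝ⟯} (hf : f ∈ firstClassFunctions (F := F) Ω ι)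
    (hc : ∀ t, c (ι t) = 0) (s : S) : Ω.bracket c f (ι s) = 0 := by
  obtain ⟨w, hw⟩ := hf s
  rw [Ω.bracket_eq]
  refine (congrArg (differential c (ι s)) hw).symm.trans
    ((differential_comp_apply c hι s w).symm.trans ?_)
  have e : c ∘ ι = fun _ => (0 : ℝ) := funext hc
  rw [e, mfderiv_const]
  rfl

/-- First class functions are closed under the bracket: by the Jacobi identity, the bracket of two
of them preserves the ideal of all functions that vanish on the submanifold, since they do so
themselves, and this property detects tangency. -/
theorem smoothBracket_mem_firstClassFunctions [T2Space N] [IsManifold 𝓘(ℝ, F) ∞ S]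
    (hι : Manifold.IsSmoothEmbedding 𝓘(ℝ, F) 𝓘(ℝ, E) ∞ ι) {f g : C^∞⟮𝓘(ℝ, E), N; ℝ⟯}
    (hf : f ∈ firstClassFunctions (F := F) Ω ι) (hg : g ∈ firstClassFunctions (F := F) Ω ι) :
    Ω.smoothBracket f g ∈ firstClassFunctions (F := F) Ω ι := fun s => by
  refine mem_range_mfderiv_of_differential_eq_zero hι fun c hc => ?_
  have h := Ω.jacobi f g c (ι s)
  rw [Ω.bracket_swap _ f, Ω.bracket_swap _ g] at h
  rw [bracket_firstClass_eq_zero hι.contMDiff hf (fun t => ?_),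
    bracket_firstClass_eq_zero hι.contMDiff hg (fun t => ?_), neg_zero, zero_add, zero_add] at h
  · exact (Ω.bracket_eq c _ (ι s)).symm.trans h
  · exact bracket_firstClass_eq_zero hι.contMDiff hf hc t
  · change Ω.bracket g c (ι t) = 0
    rw [Ω.bracket_swap, bracket_firstClass_eq_zero hι.contMDiff hg hc, neg_zero]

end Closure

/-! ### The isomorphism of Poisson algebras -/

theorem lemma3p7
    {E : Type*} [NormedAddCommGroup E] [NormedSpace ℝ E] [FiniteDimensional ℝ E]
    {F : Type*} [NormedAddCommGroup F] [NormedSpace ℝ F] [FiniteDimensional ℝ F]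
    {B : Type*} [NormedAddCommGroup B] [NormedSpace ℝ B] [FiniteDimensional ℝ B]
    -- the symplectic manifold `(N, Ω)`
    {N : Type*} [TopologicalSpace N] [T2Space N] [SecondCountableTopology N]
    [ChartedSpace E N] [IsManifold 𝓘(ℝ, E) ∞ N] (Ω : SymplecticForm E N)
    -- the closed submanifold `M_c`, with inclusion `ι`
    {Mc : Type*} [TopologicalSpace Mc] [ChartedSpace F Mc] [IsManifold 𝓘(ℝ, F) ∞ Mc]
    (ι : Mc → N) (hι : Manifold.IsSmoothEmbedding 𝓘(ℝ, F) 𝓘(ℝ, E) ∞ ι)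
    (hclosed : IsClosed (Set.range ι))
    -- the foliation `K_c` defined by the distribution `ker ω_c`, of constant rank `r`
    (r : ℕ) (Kc : Setoid Mc) (hK : IsFoliationBy (TwoForm.ker (TwoForm.pullback (F := F) ι Ω.form)) r Kc)
    -- it is regular: the leaf space is a manifold and the projection onto it is a submersion
    [ChartedSpace B (Quotient Kc)] [IsManifold 𝓘(ℝ, B) ∞ (Quotient Kc)]
    (hp : Manifold.IsSubmersion 𝓘(ℝ, F) 𝓘(ℝ, B) ∞ (Quotient.mk Kc)) :
    -- the symplectic form of the leaf space
    ∃ Ωbar : SymplecticForm B (Quotient Kc),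
      (∀ Ω' : SymplecticForm B (Quotient Kc),
        TwoForm.pullback (F := F) (Quotient.mk Kc) Ω'.form
          = TwoForm.pullback (F := F) ι Ω.form ↔ Ω' = Ωbar) ∧
    -- the Poisson algebras `R`, `R / I` and `C^∞(M_c / K_c)`
    ∃ (PR : PoissonStructure (firstClassFunctions (F := F) Ω ι))
      (PQ : PoissonStructure
        (firstClassFunctions (F := F) Ω ι ⧸ firstClassConstraints (F := F) Ω ι))
      (PB : PoissonStructure C^∞⟮𝓘(ℝ, B), Quotient Kc; ℝ⟯),
      (∀ f g x, (PR.bracket f g : C^∞⟮𝓘(ℝ, E), N; ℝ⟯) x = Ω.bracket f g x) ∧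
      (∀ f g, PQ.bracket (Ideal.Quotient.mk _ f) (Ideal.Quotient.mk _ g)
        = Ideal.Quotient.mk _ (PR.bracket f g)) ∧
      (∀ f g z, PB.bracket f g z = Ωbar.bracket f g z) ∧
    -- the map `p_*`
    ∃ pushforward : firstClassFunctions (F := F) Ω ι →ₐ[ℝ] C^∞⟮𝓘(ℝ, B), Quotient Kc; ℝ⟯,
      (∀ f (s : Mc), pushforward f (Quotient.mk Kc s) = (f : C^∞⟮𝓘(ℝ, E), N; ℝ⟯) (ι s)) ∧
      (∀ f g, pushforward (PR.bracket f g) = PB.bracket (pushforward f) (pushforward g)) ∧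
      Function.Surjective pushforward ∧
      RingHom.ker pushforward = firstClassConstraints (F := F) Ω ι ∧
    -- the induced isomorphism of Poisson algebras
    ∃ e : (firstClassFunctions (F := F) Ω ι ⧸ firstClassConstraints (F := F) Ω ι)
        ≃ₐ[ℝ] C^∞⟮𝓘(ℝ, B), Quotient Kc; ℝ⟯,
      (∀ f, e (Ideal.Quotient.mk _ f) = pushforward f) ∧
      (∀ a b, e (PQ.bracket a b) = PB.bracket (e a) (e b)) := by
  have hpull := (pullback_eq_iff hι.contMDiff hK hp _).mpr rfl
  let Ωbar := reducedSymplecticForm hι.contMDiff hK hp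
  refine ⟨Ωbar, pullback_eq_iff hι.contMDiff hK hp, ?_⟩
  let push := firstClassPushforward hK hp hι.contMDiff hpull
  have hsurj : Function.Surjective push := fun g => by
    obtain ⟨f, hf, hfg⟩ := exists_firstClass_extension hι hclosed hp Ωbar hpull g
    refine ⟨⟨f, hf⟩, ?_⟩
    ext b
    obtain ⟨s, rfl⟩ := Quotient.exists_rep b
    exact hfg s
  have hker := ker_firstClassPushforward hK hp hι.contMDiff hpull
  let PR := Ω.poisson.restrict (firstClassFunctions (F := F) Ω ι)
    fun f hf g hg => smoothBracket_mem_firstClassFunctions hι hf hg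
  let e := (Ideal.quotientEquivAlgOfEq ℝ hker.symm).trans
    (Ideal.quotientKerAlgEquivOfSurjective hsurj)
  have he : ∀ f, e (Ideal.Quotient.mk _ f) = push f := fun f => rfl
  have hbracket : ∀ f g, push (PR.bracket f g) = Ωbar.poisson.bracket (push f) (push g) :=
    fun f g => by
      ext b
      obtain ⟨s, rfl⟩ := Quotient.exists_rep b
      exact (bracket_reduction hι.contMDiff hp.contMDiff hpull f.2 g.2 (fun _ => rfl) (fun _ => rfl)
        (surjective_mfderiv_mk hp s)).symm
  refine ⟨PR, Ωbar.poisson.comap e, Ωbar.poisson, fun f g x => rfl, fun f g => ?_,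
    fun f g z => rfl, push, fun f s => rfl, hbracket, hsurj, hker, e, he, fun a b => ?_⟩
  · exact e.injective ((e.apply_symm_apply _).trans (hbracket f g).symm)
  · exact e.apply_symm_apply _
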